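/- **Setting.** Let $G=(V,E)$ be a finite $d$-regular graph, $d\ge 1$, and $\log=\log_2$. For $S\subseteq C\subseteq V$, $S\neq\emptyset$, let $\phi_C(S)=\frac{|E(S,C\setminus S)|}{d|S|}$. The outer conductance of a nonempty $S$ is $\phi(S)=\phi_V(S)$; the internal conductance of $C$ is $\min\{\phi_C(S): S\subseteq C,\ 0<|S|\le |C|/2\}$ if $|C|>1$, and $1$ otherwise. A $(k,\varphi,\epsilon)$-clustering of $G$ (with balance $\beta$) is a partition of $V$ into nonempty sets $C_1,\dots,C_k$, each with internal conductance at least $\varphi$ and outer conductance at most $\epsilon$, such that $|C_i|/|C_j|\le\beta$ for all $i,j$. Let $u_1,\dots,u_n$ be any orthonormal basis of eigenvectors of $L=I-\frac1dA_G$, in increasing order of eigenvalue; put $f_x=(u_1(x),\dots,u_k(x))\in\mathbb R^k$ for $x\in V$ and $\mu_i=\frac1{|C_i|}\sum_{x\in C_i}f_x$. For $y\in\mathbb R^k$ let $H(y)=\{x\in V:\langle f_x,y\rangle\ge 0.93\,\|y\|^2\}$. For sets of centers $P,R\subseteq\{\mu_1,\dots,\mu_k\}$ and a center $\mu\in R$,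 let $$X_{P,R}(\mu)=H(\Pi\mu)\setminus\bigcup_{\mu'\in R\setminus\{\mu\}}H(\Pi\mu'),\qquad \Pi=\text{orthogonal projection onto }\operatorname{span}(P)^\perp .$$ **Algorithms (with exact means, dot products and outer conductances).** Given disjoint sets of centers $T_1,\dots,T_b$, *HyperplanePartitioning*$(x,(T_1,\dots,T_b))$ goes through $i=1,\dots,b$ and through $\mu\in T_i$, and returns the first $\mu$ with $x\in X_{P_i,R_i}(\mu)$, where $P_i=\bigcup_{j<i}T_j$ and $R_i=\bigcup_{j\ge i}T_j$ (it may return nothing). If $(T_1,\dots,T_b)$ is an ordered partition of $\{\mu_1,\dots,\mu_k\}$, it induces the clusters $\widehat C_{\mu_i}=\{x\in V:\textit{HyperplanePartitioning}(x,(T_1,\dots,T_b))=\mu_i\}$. For $(T_1,\dots,T_b)$, a set $S$ of unprocessed centers and $\mu\in S$, the candidate cluster of $\mu$ is the set of all $x\in X_{P,S}(\mu)$, $P=\bigcup_{j\le b}T_j$, such that $x\notin X_{P_i,R_i\cup S}(\mu')$ for all $i\le b$ and all $\mu'\in T_i$. *ComputeOrderedPartition* starts with $S=\{\mu_1,\dots,\mu_k\}$.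 In iteration $i=1,\dots,\lceil\log k\rceil$ it lets $T_i$ be the set of those $\mu\in S$ whose candidate cluster $\widehat C$ with respect to $(T_1,\dots,T_{i-1})$ and $S$ satisfies $\psi(\widehat C)\le A\,\frac{\epsilon}{\varphi^2}\log k$, and replaces $S$ by $S\setminus T_i$; if now $S=\emptyset$ it returns $(\textsc{True},(T_1,\dots,T_i))$. If this never happens, it returns $(\textsc{False},\bot)$. Here $A$ is a constant of the algorithm, and $\psi$ is the exact outer-conductance procedure with size cutoff $r$: $\psi(\widehat C)=\infty$ if $\widehat C=\emptyset$ or $|\widehat C|<r$, and $\psi(\widehat C)=\phi(\widehat C)$ otherwise; $r$ is any real number with $r\le\frac12\min_p|C_p|$ (for $r\le 0$, $\psi=\phi$ on all nonempty sets). **Theorem.** For every $\beta$ there is a constant $A_0>0$ such that for every $A\ge A_0$ there are constants $c,B>0$ (depending only on $\beta$ and $A$) with the following property. Let $k\ge2$, $\varphi\in(0,1)$, $\epsilon\ge0$ and $\frac{\epsilon}{\varphi^2}\log k\le c$. Let $G$ be a $d$-regular graph with $(k,\varphi,\epsilon)$-clustering $C_1,\dots,C_k$ with balance $\beta$. Then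 $\mu_1,\dots,\mu_k$ are distinct, *ComputeOrderedPartition*, run with the exact means $\mu_1,\dots,\mu_k$, exact dot products and exact outer conductances, returns $(\textsc{True},(T_1,\dots,T_b))$ where $(T_1,\dots,T_b)$ is an ordered partition of $\{\mu_1,\dots,\mu_k\}$, and there is a permutation $\pi$ of $\{1,\dots,k\}$ such that for all $i$ the induced cluster $\widehat C_{\mu_i}$ is nonempty, $$|\widehat C_{\mu_i}\,\triangle\,C_{\pi(i)}|\le B\,\frac{\epsilon}{\varphi^3}\log(k)\,|C_{\pi(i)}|\qquad\text{and}\qquad\phi(\widehat C_{\mu_i})\le B\,\frac{\epsilon}{\varphi^2}\log k .$$ -/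

import Mathlib

open scoped InnerProductSpace

noncomputable section

namespace SpectralClustering

/-- The subsets `S ⊆ C` with `0 < |S| ≤ |C| / 2`. -/
def smallSubsets {V : Type*} (C : Finset V) : Finset (Finset V) :=
  C.powerset.filter fun S => 0 < S.card ∧ 2 * S.card ≤ C.card

theorem smallSubsets_nonempty {V : Type*} {C : Finset V} (h : 1 < C.card) : (smallSubsets C).Nonempty := by
  obtain ⟨x, hx⟩ : C.Nonempty := Finset.card_pos.mp (by omega)
  refine ⟨{x}, ?_⟩
  simp only [smallSubsets, Finset.mem_filter, Finset.mem_powerset, Finset.singleton_subset_iff,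
    Finset.card_singleton]
  exact ⟨hx, by omega, by omega⟩

section Graphs

variable {V : Type*} [Fintype V] [DecidableEq V] (G : SimpleGraph V) [DecidableRel G.Adj] (d : ℕ)

/-- The conductance `|E(S, C \ S)| / (d |S|)` of `S` within `C`.  As `S` and `C \ S` are disjoint,
every edge between them is counted once by `interedges`. -/
def conductanceWithin (C S : Finset V) : ℝ :=
  ((G.interedges S (C \ S)).card : ℝ) / ((d : ℝ) * (S.card : ℝ))

/-- The external (outer) conductance `|E(C, V \ C)| / (d |C|)` of a nonempty set `C`. -/
def outerConductance (C : Finset V) : ℝ :=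
  conductanceWithin G d Finset.univ C

/-- The internal conductance of `C`: the minimum of the conductance within `C` over all `S ⊆ C` with
`0 < |S| ≤ |C| / 2` if `|C| > 1`, and one otherwise. -/
def internalConductance (C : Finset V) : ℝ :=
  if h : 1 < C.card then
    (smallSubsets C).inf' (smallSubsets_nonempty h) (conductanceWithin G d C)
  else 1

/-- `C 0, …, C (k - 1)` is a `(k, φ, ε)`-clustering of the `d`-regular graph `G`, with all ratios
of cluster sizes bounded by `β`. -/
structure IsClustering {k : ℕ} (phi eps β : ℝ) (C : Fin k → Finset V) : Prop where
  nonempty : ∀ i, (C i).Nonempty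
  disjoint : ∀ i j, i ≠ j → Disjoint (C i) (C j)
  cover : ∀ x, ∃ i, x ∈ C i
  internal : ∀ i, phi ≤ internalConductance G d (C i)
  outer : ∀ i, outerConductance G d (C i) ≤ eps
  balanced : ∀ i j, ((C i).card : ℝ) / ((C j).card : ℝ) ≤ β

/-- The normalized Laplacian `I - A / d` of a `d`-regular graph. -/
def normalizedLaplacian : Matrix V V ℝ :=
  1 - (1 / (d : ℝ)) • G.adjMatrix ℝ

/-- `f` is a spectral embedding: for some orthonormal basis `u` of eigenvectors of the normalized
Laplacian, listed by increasing eigenvalue, the `j`-th coordinate of `f x` is the entry at `x` of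
the `j`-th basis vector, for the first `k` basis vectors. -/
def IsSpectralEmbedding {k : ℕ} (f : V → EuclideanSpace ℝ (Fin k)) : Prop :=
  ∃ (hk : k ≤ Fintype.card V)
    (u : OrthonormalBasis (Fin (Fintype.card V)) ℝ (EuclideanSpace ℝ V))
    (lam : Fin (Fintype.card V) → ℝ),
    Monotone lam ∧
    (∀ i, (normalizedLaplacian G d).mulVec (u i).ofLp = lam i • (u i).ofLp) ∧
    ∀ x j, f x j = u (Fin.castLE hk j) x

end Graphs

section Algorithms

variable {V : Type*} [Fintype V] [DecidableEq V] {k : ℕ}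

/-- The mean `μ_i` of the embedded vertices of the cluster `C i`. -/
def clusterMean (f : V → EuclideanSpace ℝ (Fin k)) (C : Fin k → Finset V) (i : Fin k) :
    EuclideanSpace ℝ (Fin k) :=
  (1 / ((C i).card : ℝ)) • ∑ x ∈ C i, f x

open Classical in
/-- The threshold set `{x : ⟨f x, y⟩ ≥ θ ‖y‖²}`, with exact dot products. -/
def thresholdSet (f : V → EuclideanSpace ℝ (Fin k)) (y : EuclideanSpace ℝ (Fin k)) (θ : ℝ) :
    Finset V :=
  Finset.univ.filter fun x => θ * ‖y‖ ^ 2 ≤ ⟪f x, y⟫_ℝ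

/-! Below, a family `μ` of centers is given, and sets of centers are represented by the sets of
their indices (which is the same thing whenever `μ` is injective). -/

variable (f : V → EuclideanSpace ℝ (Fin k)) (μ : Fin k → EuclideanSpace ℝ (Fin k))

/-- `Π (μ i)` for the orthogonal projection `Π` onto the orthogonal complement of the span of the
centers in `P`. -/
def projCenter (P : Finset (Fin k)) (i : Fin k) : EuclideanSpace ℝ (Fin k) :=
  ((Submodule.span ℝ (μ '' (P : Set (Fin k))))ᗮ).starProjection (μ i)

/-- The vertices in the threshold set of `Π (μ i)`, but in that of no `Π (μ j)` with
`j ∈ R \ {i}`, where `Π` projects out the centers in `P` and the threshold is `0.93`. -/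
def exclusiveSet (P R : Finset (Fin k)) (i : Fin k) : Finset V :=
  thresholdSet f (projCenter μ P i) 0.93 \
    (R.erase i).biUnion fun j => thresholdSet f (projCenter μ P j) 0.93

/-- The union of the sets in a list. -/
def unionOf (Ts : List (Finset (Fin k))) : Finset (Fin k) :=
  Ts.foldr (· ∪ ·) ∅

/-- The loop of `HyperplanePartitioning`: `P` is the union of the stages already passed, the list
holds the stages still to come.  The centers of a stage are scanned in the order of their indices;
at most one of them satisfies the test. -/
def hyperplanePartitioningFrom (x : V) :
    Finset (Fin k) → List (Finset (Fin k)) → Option (Fin k)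
  | _, [] => none
  | P, T :: Ts =>
    match (List.finRange k).find?
        (fun j => decide (j ∈ T ∧ x ∈ exclusiveSet f μ P (T ∪ unionOf Ts) j)) with
    | some j => some j
    | none => hyperplanePartitioningFrom x (P ∪ T) Ts

/-- `HyperplanePartitioning(x, (T_1, …, T_b))`; the result `none` means that no center is
returned. -/
def hyperplanePartitioning (Ts : List (Finset (Fin k))) (x : V) : Option (Fin k) :=
  hyperplanePartitioningFrom f μ x ∅ Ts

/-- The cluster of the center `i` that is induced by the ordered partition `Ts`. -/
def inducedCluster (Ts : List (Finset (Fin k))) (i : Fin k) : Finset V :=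
  Finset.univ.filter fun x => hyperplanePartitioning f μ Ts x = some i

/-- The loop of `IsInside`: `P` is the union of the stages already passed, the list holds the
stages still to come, `S` is the set of unprocessed centers. -/
def IsInsideFrom (x : V) (i : Fin k) (S : Finset (Fin k)) :
    Finset (Fin k) → List (Finset (Fin k)) → Prop
  | P, [] => x ∈ exclusiveSet f μ P S i
  | P, T :: Ts =>
    if ∃ j ∈ T, x ∈ exclusiveSet f μ P (T ∪ unionOf Ts ∪ S) j then False
    else IsInsideFrom x i S (P ∪ T) Ts

/-- `IsInside(x, μ i, (T_1, …, T_b), S)` returns true. -/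
def IsInside (x : V) (i : Fin k) (Ts : List (Finset (Fin k))) (S : Finset (Fin k)) : Prop :=
  IsInsideFrom f μ x i S ∅ Ts

open Classical in
/-- The candidate cluster of the center `i` with respect to the stages `Ts` and the unprocessed
centers `S`. -/
def candidateCluster (i : Fin k) (Ts : List (Finset (Fin k))) (S : Finset (Fin k)) : Finset V :=
  Finset.univ.filter fun x => IsInside f μ x i Ts S

variable (G : SimpleGraph V) [DecidableRel G.Adj] (d : ℕ)

open Classical in
/-- The exact version of `OuterConductance`: the outer conductance of the candidate cluster, and
`∞` if the candidate cluster is empty or has fewer than `r` vertices. -/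
def exactOuterConductance (r : ℝ) (i : Fin k) (Ts : List (Finset (Fin k)))
    (S : Finset (Fin k)) : EReal :=
  if candidateCluster f μ i Ts S = ∅ ∨ ((candidateCluster f μ i Ts S).card : ℝ) < r then ⊤
  else ((outerConductance G d (candidateCluster f μ i Ts S) : ℝ) : EReal)

open Classical in
/-- The main loop of `ComputeOrderedPartition`, with at most `m` iterations to go, from the stages
`Ts` and the set `S` of unprocessed centers; `τ` is the bound of the conductance test.  The result
`none` stands for `(False, ⊥)`, and `some Ts` for `(True, Ts)`. -/
def computeOrderedPartitionLoop (r τ : ℝ) :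
    ℕ → List (Finset (Fin k)) → Finset (Fin k) → Option (List (Finset (Fin k)))
  | 0, _, _ => none
  | m + 1, Ts, S =>
    let T := S.filter fun i => exactOuterConductance f μ G d r i Ts S ≤ (τ : EReal)
    if S \ T = ∅ then some (Ts ++ [T])
    else computeOrderedPartitionLoop r τ m (Ts ++ [T]) (S \ T)

/-- `ComputeOrderedPartition` with exact dot products and exact outer conductances: `⌈log₂ k⌉`
iterations, starting from the set of all centers. -/
def computeOrderedPartition (r τ : ℝ) : Option (List (Finset (Fin k))) :=
  computeOrderedPartitionLoop f μ G d r τ ⌈Real.logb 2 k⌉₊ [] Finset.univ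

/-- `(T_1, …, T_b)` is an ordered partition of the set of all `k` centers. -/
def IsOrderedPartition (Ts : List (Finset (Fin k))) : Prop :=
  Ts.Pairwise Disjoint ∧ ∀ i, ∃ T ∈ Ts, i ∈ T

end Algorithms

end SpectralClustering

end

open SpectralClustering

/-!
The argument rests on one fact about the first `k` eigenvectors.  On each cluster Cheeger's
inequality (`cheeger_variance`) bounds the variance of a function `v` by its energy, with factor
`φ² / 2`; and the `k`-th eigenvalue is at most `2 ε`, because the indicators of the clusters span a
`k`-dimensional space of energy at most `2 ε` (`eigenvalue_le`).  Hence in every direction `α` the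
embedded vertices have total variance at most `δ ‖α‖²` around their cluster means, `δ = 4 ε / φ²`,
while the embedding itself is isotropic (`IsSpectralEmbedding.isotropic_and_variance_le`).

It follows that the means `μ i`, scaled by `√|C i|`, form a frame of `k` vectors in dimension `k`
with bounds `1 - δ` and `1`, that is, nearly an orthonormal basis.  Consequently, after projecting
out any set of means, every other mean keeps its length up to a factor `1 - δ`, and two of them have
inner product at most `δ (1 / |C i| + 1 / |C j|) / 2` (`le_norm_sq_projCenter`,
`inner_projCenter_le`).  With Markov's inequality, each threshold set `H (Π (μ i))` differs from
`C i` in at most `η |C i|` vertices, `η = 1000 ε / φ²` (`card_symmDiff_thresholdSet_le`).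

A candidate cluster differs from `C i` for three reasons: the error of its own threshold set, the
vertices of `C i` in threshold sets of other unprocessed centers, and the vertices taken away by
earlier stages.  As `μ i` was competing in each earlier stage, such a stage takes away only vertices
that miss the threshold set of `μ i` there, at most `η |C i|` of them (`card_not_isInsideFrom_le`);
this is where `log k` comes from.  The overlaps are small on average over the unprocessed centers,
so that at least three quarters of these pass the conductance test in each stage
(`four_mul_card_large_overlap_le`), and `⌈log k⌉` stages exhaust all centers
(`computeOrderedPartitionLoop_spec`).

The cluster induced by the final partition is the candidate cluster at the time of acceptance
(`inducedCluster_eq_candidateCluster`), so its conductance has been tested.  A center may be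
accepted although its overlaps are large; its cluster still lies in `C i` up to `η |C i|` vertices,
and the internal expansion of the clusters turns its small conductance into a bound on the part of
`C i` that it misses, at the price of one more factor `1 / φ`
(`card_sdiff_le_of_outerConductance_le`).  The permutation is the identity.
-/

namespace SpectralClustering

/-! ### Cheeger's inequality on a cluster -/

theorem sum_sq_sub_mean_le {V : Type*} (C : Finset V) (v : V → ℝ) (m : ℝ) :
    ∑ x ∈ C, (v x - (1 / (C.card : ℝ)) * ∑ y ∈ C, v y) ^ 2 ≤ ∑ x ∈ C, (v x - m) ^ 2 := by
  rcases C.eq_empty_or_nonempty with rfl | hne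
  · simp
  have hc : (0 : ℝ) < C.card := by exact_mod_cast hne.card_pos
  set a := (1 / (C.card : ℝ)) * ∑ y ∈ C, v y with ha
  have hs : ∑ y ∈ C, v y = C.card * a := by rw [ha]; field_simp
  have : ∑ x ∈ C, (v x - m) ^ 2 - ∑ x ∈ C, (v x - a) ^ 2 = C.card * (a - m) ^ 2 := by
    rw [← Finset.sum_sub_distrib]
    have : ∀ x ∈ C, (v x - m) ^ 2 - (v x - a) ^ 2 = 2 * (a - m) * v x + (m ^ 2 - a ^ 2) :=
      fun x _ => by ring
    rw [Finset.sum_congr rfl this, Finset.sum_add_distrib, ← Finset.mul_sum, hs,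
      Finset.sum_const, nsmul_eq_mul]
    ring
  nlinarith [mul_nonneg hc.le (sq_nonneg (a - m))]

section Cheeger

variable {V : Type*} [DecidableEq V]

/-- A nonnegative function supported on at most half of `C` has total variation at least `2 h` times
its sum, where `h` is the expansion of the small subsets of `C`.  Instead of integrating over level
sets, the induction removes the lowest layer of the function. -/
theorem coarea_inequality (w : V → V → ℝ) (hsymm : ∀ x y, w x y = w y x)
    (hw : ∀ x y, 0 ≤ w x y) (C : Finset V) (h : ℝ)
    (hexp : ∀ S ⊆ C, S.Nonempty → 2 * S.card ≤ C.card →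
      h * S.card ≤ ∑ x ∈ S, ∑ y ∈ C \ S, w x y) :
    ∀ (n : ℕ) (q : V → ℝ), (∀ x ∈ C, 0 ≤ q x) → (C.filter fun x => 0 < q x).card = n →
      2 * n ≤ C.card →
      2 * h * ∑ x ∈ C, q x ≤ ∑ x ∈ C, ∑ y ∈ C, w x y * |q x - q y| := by
  intro n
  induction n using Nat.strong_induction_on with
  | _ n ih =>
  intro q hq hn hle
  set S := C.filter fun x => 0 < q x with hS
  have hSC : S ⊆ C := Finset.filter_subset _ _
  rcases S.eq_empty_or_nonempty with h0 | hne
  · have hz : ∑ x ∈ C, q x = 0 := by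
      refine Finset.sum_eq_zero fun x hx => le_antisymm ?_ (hq x hx)
      by_contra hpos
      have : x ∈ S := Finset.mem_filter.2 ⟨hx, not_le.1 hpos⟩
      simp [h0] at this
    rw [hz, mul_zero]
    exact Finset.sum_nonneg fun x _ => Finset.sum_nonneg fun y _ =>
      mul_nonneg (hw x y) (abs_nonneg _)
  obtain ⟨z, hz, hmin⟩ := S.exists_min_image q hne
  have ht : 0 < q z := (Finset.mem_filter.1 hz).2
  set t := q z with htdef
  -- the lowest layer `t` of `q` is removed from its support `S`
  let q' : V → ℝ := fun x => if x ∈ S then q x - t else q x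
  have hout : ∀ x ∈ C, x ∉ S → q x = 0 := fun x hx hxS => by
    refine le_antisymm ?_ (hq x hx)
    by_contra hpos
    exact hxS (Finset.mem_filter.2 ⟨hx, not_le.1 hpos⟩)
  have hq' : ∀ x ∈ C, 0 ≤ q' x := fun x hx => by
    by_cases hxS : x ∈ S
    · simp only [q', hxS, if_true]; linarith [hmin x hxS]
    · simp only [q', hxS, if_false]; exact hq x hx
  have hsub : (C.filter fun x => 0 < q' x) ⊂ S := by
    refine Finset.ssubset_iff_subset_ne.2 ⟨fun x hx => ?_, fun he => ?_⟩
    · obtain ⟨hxC, hpos⟩ := Finset.mem_filter.1 hx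
      by_contra hxS
      simp [q', hxS, hout x hxC hxS] at hpos
    · rw [← he] at hz
      have := (Finset.mem_filter.1 hz).2
      have hzS : z ∈ S := by rw [← he]; exact hz
      simp [q', hzS, htdef] at this
  have hlt := Finset.card_lt_card hsub
  have key := ih _ (hn ▸ hlt) q' hq' rfl (by omega)
  have hcut := hexp S hSC hne (by omega)
  have hsum : ∑ x ∈ C, q x = ∑ x ∈ C, q' x + t * S.card := by
    have : ∀ x ∈ C, q x = q' x + if x ∈ S then t else 0 := fun x _ => by
      by_cases hxS : x ∈ S <;> simp [q', hxS]
    rw [Finset.sum_congr rfl this, Finset.sum_add_distrib, ← Finset.sum_filter,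
      Finset.filter_mem_eq_inter, Finset.inter_eq_right.2 hSC, Finset.sum_const, nsmul_eq_mul,
      mul_comm t]
  have hpair : ∀ x ∈ C, ∀ y ∈ C, w x y * |q x - q y| = w x y * |q' x - q' y| +
      t * ((if x ∈ S then if y ∈ C \ S then w x y else 0 else 0) +
        (if y ∈ S then if x ∈ C \ S then w y x else 0 else 0)) := fun x hx y hy => by
    by_cases hxS : x ∈ S <;> by_cases hyS : y ∈ S
    · simp [q', hxS, hyS]
    · have h1 := hmin x hxS
      simp only [q', hxS, hyS, hx, hy, if_true, if_false, Finset.mem_sdiff, hout y hy hyS,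
        not_true_eq_false, not_false_eq_true, and_self, and_false, sub_zero, add_zero]
      rw [abs_of_nonneg (by linarith), abs_of_nonneg (by linarith)]; ring
    · have h1 := hmin y hyS
      simp only [q', hxS, hyS, hx, hy, if_true, if_false, Finset.mem_sdiff, hout x hx hxS,
        not_true_eq_false, not_false_eq_true, and_self, and_false, zero_sub, zero_add, hsymm y x]
      rw [abs_of_nonpos (by linarith), abs_of_nonpos (by linarith)]; ring
    · simp [q', hxS, hyS]
  have hrect : ∑ x ∈ C, ∑ y ∈ C, (if x ∈ S then if y ∈ C \ S then w x y else 0 else 0) =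
      ∑ x ∈ S, ∑ y ∈ C \ S, w x y := by
    have : ∀ x ∈ C, ∑ y ∈ C, (if x ∈ S then if y ∈ C \ S then w x y else 0 else 0) =
        if x ∈ S then ∑ y ∈ C \ S, w x y else 0 := fun x _ => by
      by_cases hxS : x ∈ S
      · simp only [hxS, if_true]
        rw [← Finset.sum_filter, Finset.filter_mem_eq_inter,
          Finset.inter_eq_right.2 Finset.sdiff_subset]
      · simp [hxS]
    rw [Finset.sum_congr rfl this, ← Finset.sum_filter, Finset.filter_mem_eq_inter,
      Finset.inter_eq_right.2 hSC]
  have hrect' : ∑ x ∈ C, ∑ y ∈ C, (if y ∈ S then if x ∈ C \ S then w y x else 0 else 0) =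
      ∑ x ∈ S, ∑ y ∈ C \ S, w x y := by
    rw [Finset.sum_comm, hrect]
  have hE : ∑ x ∈ C, ∑ y ∈ C, w x y * |q x - q y| =
      ∑ x ∈ C, ∑ y ∈ C, w x y * |q' x - q' y| + t * (2 * ∑ x ∈ S, ∑ y ∈ C \ S, w x y) := by
    rw [Finset.sum_congr rfl fun x hx => Finset.sum_congr rfl fun y hy => hpair x hx y hy]
    simp only [Finset.sum_add_distrib, ← Finset.mul_sum, hrect, hrect']
    ring
  rw [hE, hsum]
  nlinarith

/-- The energy of a nonnegative function supported on at most half of `C` is bounded below by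
Cauchy–Schwarz, applied to the coarea inequality for its square. -/
theorem cheeger_half (w : V → V → ℝ) (hsymm : ∀ x y, w x y = w y x)
    (hw : ∀ x y, 0 ≤ w x y) (C : Finset V) (φ D : ℝ) (hφ : 0 < φ) (hD : 0 < D)
    (hdeg : ∀ x, ∑ y ∈ C, w x y ≤ D)
    (hexp : ∀ S ⊆ C, S.Nonempty → 2 * S.card ≤ C.card →
      φ * D * S.card ≤ ∑ x ∈ S, ∑ y ∈ C \ S, w x y)
    (g : V → ℝ) (hg : ∀ x, 0 ≤ g x) (hsupp : 2 * (C.filter fun x => 0 < g x).card ≤ C.card) :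
    φ ^ 2 * D * ∑ x ∈ C, g x ^ 2 ≤ ∑ x ∈ C, ∑ y ∈ C, w x y * (g x - g y) ^ 2 := by
  have hco := coarea_inequality w hsymm hw C (φ * D) hexp _ (fun x => g x ^ 2)
    (fun x _ => sq_nonneg _) rfl (by
      convert hsupp using 4 with x
      exact ⟨fun h => (hg x).lt_of_ne fun h0 => by simp [← h0] at h, fun h => by positivity⟩)
  set N := ∑ x ∈ C, g x ^ 2 with hN
  set E := ∑ x ∈ C, ∑ y ∈ C, w x y * (g x - g y) ^ 2 with hE
  set F := ∑ x ∈ C, ∑ y ∈ C, w x y * (g x + g y) ^ 2 with hF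
  set Q := ∑ x ∈ C, ∑ y ∈ C, w x y * |g x ^ 2 - g y ^ 2| with hQ
  have hN0 : 0 ≤ N := Finset.sum_nonneg fun x _ => sq_nonneg _
  have hE0 : 0 ≤ E := Finset.sum_nonneg fun x _ => Finset.sum_nonneg fun y _ =>
    mul_nonneg (hw x y) (sq_nonneg _)
  have hcs : Q ^ 2 ≤ E * F := by
    simp only [hQ, hE, hF, ← Finset.sum_product']
    refine Finset.sum_sq_le_sum_mul_sum_of_sq_le_mul _
      (fun p _ => mul_nonneg (hw _ _) (sq_nonneg _)) (fun p _ => mul_nonneg (hw _ _) (sq_nonneg _))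
      fun p _ => ?_
    rw [mul_pow, sq_abs]; exact le_of_eq (by ring)
  have hone : ∑ x ∈ C, ∑ y ∈ C, w x y * g x ^ 2 ≤ D * N := by
    rw [hN, Finset.mul_sum]
    refine Finset.sum_le_sum fun x _ => ?_
    rw [← Finset.sum_mul]
    exact mul_le_mul_of_nonneg_right (hdeg x) (sq_nonneg _)
  have htwo : ∑ x ∈ C, ∑ y ∈ C, w x y * g y ^ 2 ≤ D * N := by
    rw [Finset.sum_comm]
    refine (Finset.sum_congr rfl fun x _ => Finset.sum_congr rfl fun y _ => ?_).trans_le hone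
    rw [hsymm]
  have hF4 : F ≤ 4 * (D * N) := by
    have : F ≤ ∑ x ∈ C, ∑ y ∈ C, (2 * (w x y * g x ^ 2) + 2 * (w x y * g y ^ 2)) := by
      refine Finset.sum_le_sum fun x _ => Finset.sum_le_sum fun y _ => ?_
      nlinarith [mul_nonneg (hw x y) (sq_nonneg (g x - g y))]
    simp only [Finset.sum_add_distrib, ← Finset.mul_sum] at this
    linarith
  have h1 : (2 * (φ * D) * N) ^ 2 ≤ E * (4 * (D * N)) :=
    (pow_le_pow_left₀ (by positivity) hco 2).trans
      (hcs.trans (mul_le_mul_of_nonneg_left hF4 hE0))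
  rcases hN0.eq_or_lt with h0 | hpos
  · rw [← h0]; simpa using hE0
  · have h2 : (4 * (D * N)) * (φ ^ 2 * D * N) ≤ (4 * (D * N)) * E := by nlinarith
    exact le_of_mul_le_mul_left h2 (by positivity)

theorem exists_median (C : Finset V) (v : V → ℝ) :
    ∃ m : ℝ, 2 * (C.filter fun x => m < v x).card ≤ C.card ∧
      2 * (C.filter fun x => v x < m).card ≤ C.card := by
  rcases C.eq_empty_or_nonempty with rfl | hne
  · exact ⟨0, by simp⟩
  -- the least value of `v` that is exceeded on at most half of `C`
  let M := C.filter fun z => 2 * (C.filter fun x => v z < v x).card ≤ C.card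
  have hM : M.Nonempty := by
    obtain ⟨z, hz, hmax⟩ := C.exists_max_image v hne
    refine ⟨z, Finset.mem_filter.2 ⟨hz, ?_⟩⟩
    rw [Finset.filter_false_of_mem fun x hx => not_lt.2 (hmax x hx)]
    simp
  obtain ⟨z, hz, hmin⟩ := M.exists_min_image v hM
  refine ⟨v z, (Finset.mem_filter.1 hz).2, ?_⟩
  by_contra hcon
  push Not at hcon
  have hne' : (C.filter fun x => v x < v z).Nonempty := by
    rw [← Finset.card_pos]; omega
  obtain ⟨y, hy, hymax⟩ := (C.filter fun x => v x < v z).exists_max_image v hne'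
  obtain ⟨hyC, hyz⟩ := Finset.mem_filter.1 hy
  have hyM : y ∉ M := fun h => not_lt.2 (hmin y h) hyz
  have h1 : ¬ 2 * (C.filter fun x => v y < v x).card ≤ C.card := fun h =>
    hyM (Finset.mem_filter.2 ⟨hyC, h⟩)
  have hdisj : Disjoint (C.filter fun x => v y < v x) (C.filter fun x => v x < v z) := by
    refine Finset.disjoint_left.2 fun x hx hx' => ?_
    exact absurd (Finset.mem_filter.1 hx).2 (not_lt.2 (hymax x hx'))
  have := Finset.card_le_card
    (Finset.union_subset (Finset.filter_subset (fun x => v y < v x) C)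
      (Finset.filter_subset (fun x => v x < v z) C))
  rw [Finset.card_union_of_disjoint hdisj] at this
  omega

/-- Cheeger's inequality: expansion `φ` inside `C` forces the energy within `C` to dominate the
variance, with factor `φ² D`.  Ordered pairs are summed, so every edge counts twice. -/
theorem cheeger_variance (w : V → V → ℝ) (hsymm : ∀ x y, w x y = w y x)
    (hw : ∀ x y, 0 ≤ w x y) (C : Finset V) (φ D : ℝ) (hφ : 0 < φ) (hD : 0 < D)
    (hdeg : ∀ x, ∑ y ∈ C, w x y ≤ D)
    (hexp : ∀ S ⊆ C, S.Nonempty → 2 * S.card ≤ C.card →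
      φ * D * S.card ≤ ∑ x ∈ S, ∑ y ∈ C \ S, w x y) (v : V → ℝ) :
    φ ^ 2 * D * ∑ x ∈ C, (v x - (1 / (C.card : ℝ)) * ∑ y ∈ C, v y) ^ 2 ≤
      ∑ x ∈ C, ∑ y ∈ C, w x y * (v x - v y) ^ 2 := by
  obtain ⟨m, hm1, hm2⟩ := exists_median C v
  -- both the positive and the negative part of `v - m` live on at most half of `C`
  have hp := cheeger_half w hsymm hw C φ D hφ hD hdeg hexp (fun x => max (v x - m) 0)
    (fun x => le_max_right _ _) (by simpa using hm1)
  have hn := cheeger_half w hsymm hw C φ D hφ hD hdeg hexp (fun x => max (m - v x) 0)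
    (fun x => le_max_right _ _) (by simpa using hm2)
  have hsq : ∑ x ∈ C, (v x - m) ^ 2 =
      ∑ x ∈ C, max (v x - m) 0 ^ 2 + ∑ x ∈ C, max (m - v x) 0 ^ 2 := by
    rw [← Finset.sum_add_distrib]
    refine Finset.sum_congr rfl fun x _ => ?_
    rcases le_total (v x) m with h | h
    · rw [max_eq_right (by linarith), max_eq_left (by linarith)]; ring
    · rw [max_eq_left (by linarith), max_eq_right (by linarith)]; ring
  have hpt : ∑ x ∈ C, ∑ y ∈ C, w x y * (max (v x - m) 0 - max (v y - m) 0) ^ 2 +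
      ∑ x ∈ C, ∑ y ∈ C, w x y * (max (m - v x) 0 - max (m - v y) 0) ^ 2 ≤
      ∑ x ∈ C, ∑ y ∈ C, w x y * (v x - v y) ^ 2 := by
    simp only [← Finset.sum_add_distrib, ← mul_add]
    refine Finset.sum_le_sum fun x _ => Finset.sum_le_sum fun y _ =>
      mul_le_mul_of_nonneg_left ?_ (hw x y)
    rcases le_total (v x) m with h | h <;> rcases le_total (v y) m with h' | h'
    · rw [max_eq_right (by linarith), max_eq_right (by linarith), max_eq_left (by linarith),
        max_eq_left (by linarith)]
      nlinarith
    · rw [max_eq_right (by linarith), max_eq_left (by linarith), max_eq_left (by linarith),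
        max_eq_right (by linarith)]
      nlinarith [mul_nonneg (sub_nonneg.2 h) (sub_nonneg.2 h')]
    · rw [max_eq_left (by linarith), max_eq_right (by linarith), max_eq_right (by linarith),
        max_eq_left (by linarith)]
      nlinarith [mul_nonneg (sub_nonneg.2 h) (sub_nonneg.2 h')]
    · rw [max_eq_left (by linarith), max_eq_left (by linarith), max_eq_right (by linarith),
        max_eq_right (by linarith)]
      nlinarith
  have hmean := mul_le_mul_of_nonneg_left (sum_sq_sub_mean_le C v m)
    (show 0 ≤ φ ^ 2 * D by positivity)
  rw [hsq] at hmean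
  linarith

end Cheeger

/-! ### The normalized Laplacian of a clustered graph -/

/-- The adjacency matrix of `G` as a real weight function on ordered pairs. -/
def edgeWeight {V : Type*} (G : SimpleGraph V) [DecidableRel G.Adj] (x y : V) : ℝ :=
  if G.Adj x y then 1 else 0

theorem edgeWeight_nonneg {V : Type*} (G : SimpleGraph V) [DecidableRel G.Adj] (x y : V) :
    0 ≤ edgeWeight G x y := by
  rw [edgeWeight]; split_ifs <;> norm_num

theorem edgeWeight_symm {V : Type*} (G : SimpleGraph V) [DecidableRel G.Adj] (x y : V) :
    edgeWeight G x y = edgeWeight G y x := by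
  simp [edgeWeight, G.adj_comm]

theorem card_interedges_eq_sum {V : Type*} (G : SimpleGraph V) [DecidableRel G.Adj]
    (S T : Finset V) :
    ((G.interedges S T).card : ℝ) = ∑ x ∈ S, ∑ y ∈ T, edgeWeight G x y := by
  rw [← Finset.sum_product', SimpleGraph.interedges, Rel.interedges, Finset.card_filter]
  push_cast
  exact Finset.sum_congr rfl fun p _ => by simp [edgeWeight]

theorem sum_edgeWeight_univ {V : Type*} [Fintype V] {G : SimpleGraph V} [DecidableRel G.Adj]
    {d : ℕ} (hG : G.IsRegularOfDegree d) (x : V) :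
    ∑ y, edgeWeight G x y = d := by
  simp [edgeWeight, ← hG.degree_eq x, SimpleGraph.degree, SimpleGraph.neighborFinset_eq_filter]

theorem le_cut_of_le_internalConductance {V : Type*} [DecidableEq V] (G : SimpleGraph V)
    [DecidableRel G.Adj] {d : ℕ} (hd : 0 < d) {C : Finset V} {φ : ℝ}
    (h : φ ≤ internalConductance G d C) {S : Finset V} (hS : S ⊆ C) (hne : S.Nonempty)
    (hcard : 2 * S.card ≤ C.card) :
    φ * d * S.card ≤ ∑ x ∈ S, ∑ y ∈ C \ S, edgeWeight G x y := by
  have hpos := hne.card_pos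
  have h1 : 1 < C.card := by omega
  rw [internalConductance, dif_pos h1, Finset.le_inf'_iff] at h
  have := h S (by simp [smallSubsets, hS, hcard, hne])
  rw [conductanceWithin, card_interedges_eq_sum, le_div_iff₀ (by positivity)] at this
  linarith

theorem sum_edgeWeight_le {V : Type*} [Fintype V] {G : SimpleGraph V} [DecidableRel G.Adj]
    {d : ℕ} (hG : G.IsRegularOfDegree d) (T : Finset V) (x : V) :
    ∑ y ∈ T, edgeWeight G x y ≤ d := by
  rw [← sum_edgeWeight_univ hG x]
  exact Finset.sum_le_sum_of_subset_of_nonneg (Finset.subset_univ _)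
    fun y _ _ => edgeWeight_nonneg G x y

theorem sum_eq_sum_clusters {V : Type*} [Fintype V] {k : ℕ} {C : Fin k → Finset V}
    {c : V → Fin k} (hc : ∀ x i, x ∈ C i ↔ c x = i) (F : V → ℝ) :
    ∑ x, F x = ∑ i, ∑ x ∈ C i, F x := by
  rw [← Finset.sum_fiberwise Finset.univ c F]
  refine Finset.sum_congr rfl fun i _ => Finset.sum_congr ?_ fun _ _ => rfl
  ext x
  simp [hc]

section Laplacian

variable {V : Type*} [Fintype V] [DecidableEq V] (G : SimpleGraph V) [DecidableRel G.Adj] {d : ℕ}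

theorem outerConductance_eq (S : Finset V) :
    outerConductance G d S = (∑ x ∈ S, ∑ y ∈ Sᶜ, edgeWeight G x y) / (d * S.card) := by
  rw [outerConductance, conductanceWithin, card_interedges_eq_sum, Finset.compl_eq_univ_sdiff]

theorem cut_le_of_outerConductance_le (hd : 0 < d) {S : Finset V} {τ : ℝ} (hne : S.Nonempty)
    (h : outerConductance G d S ≤ τ) :
    ∑ x ∈ S, ∑ y ∈ Sᶜ, edgeWeight G x y ≤ τ * d * S.card := by
  have hpos := hne.card_pos
  rw [outerConductance_eq, div_le_iff₀ (by positivity)] at h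
  linarith

variable {G}

theorem laplacian_quadratic_form (hd : 0 < d) (hG : G.IsRegularOfDegree d) (v : V → ℝ) :
    v ⬝ᵥ (normalizedLaplacian G d).mulVec v =
      1 / (2 * d) * ∑ x, ∑ y, edgeWeight G x y * (v x - v y) ^ 2 := by
  have hd' : (d : ℝ) ≠ 0 := by positivity
  have h1 : ∑ x, ∑ y, edgeWeight G x y * v x ^ 2 = d * ∑ x, v x ^ 2 := by
    rw [Finset.mul_sum]
    exact Finset.sum_congr rfl fun x _ => by rw [← Finset.sum_mul, sum_edgeWeight_univ hG]
  have h2 : ∑ x, ∑ y, edgeWeight G x y * v y ^ 2 = d * ∑ x, v x ^ 2 := by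
    rw [Finset.sum_comm, ← h1]
    exact Finset.sum_congr rfl fun x _ => Finset.sum_congr rfl fun y _ => by
      rw [edgeWeight_symm]
  have h3 : ∑ x, ∑ y, edgeWeight G x y * (v x - v y) ^ 2 =
      2 * (d * ∑ x, v x ^ 2) - 2 * ∑ x, ∑ y, v x * (edgeWeight G x y * v y) := by
    rw [two_mul (d * ∑ x, v x ^ 2)]
    nth_rw 1 [← h1]
    rw [← h2]
    simp only [Finset.mul_sum, ← Finset.sum_add_distrib, ← Finset.sum_sub_distrib]
    exact Finset.sum_congr rfl fun x _ => Finset.sum_congr rfl fun y _ => by ring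
  have h4 : v ⬝ᵥ (normalizedLaplacian G d).mulVec v =
      ∑ x, v x ^ 2 - 1 / d * ∑ x, ∑ y, v x * (edgeWeight G x y * v y) := by
    simp only [normalizedLaplacian, Matrix.sub_mulVec, Matrix.one_mulVec, Matrix.smul_mulVec,
      dotProduct_sub, dotProduct_smul, smul_eq_mul]
    simp only [dotProduct, Matrix.mulVec, SimpleGraph.adjMatrix_apply, edgeWeight, Finset.mul_sum,
      sq]
  rw [h4, h3]
  field_simp

theorem normalizedLaplacian_symm_form (v w : V → ℝ) :
    v ⬝ᵥ (normalizedLaplacian G d).mulVec w = (normalizedLaplacian G d).mulVec v ⬝ᵥ w := by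
  rw [Matrix.dotProduct_mulVec, ← Matrix.mulVec_transpose]
  congr 2
  simp [normalizedLaplacian]

variable {k : ℕ} {φ ε β : ℝ} {C : Fin k → Finset V}

theorem IsClustering.exists_label (hC : IsClustering G d φ ε β C) :
    ∃ c : V → Fin k, ∀ x i, x ∈ C i ↔ c x = i := by
  choose c hc using hC.cover
  refine ⟨c, fun x i => ⟨fun hx => ?_, fun h => h ▸ hc x⟩⟩
  by_contra hne
  exact Finset.disjoint_left.1 (hC.disjoint _ _ hne) (hc x) hx

/-- Every cluster contributes at least `φ² / 2` times the variance of `v` on it to the quadratic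
form of the Laplacian. -/
theorem variance_le_laplacian (hd : 0 < d) (hG : G.IsRegularOfDegree d) (hφ : 0 < φ)
    (hC : IsClustering G d φ ε β C) (v : V → ℝ) :
    φ ^ 2 / 2 * ∑ i, ∑ x ∈ C i, (v x - (1 / ((C i).card : ℝ)) * ∑ y ∈ C i, v y) ^ 2 ≤
      v ⬝ᵥ (normalizedLaplacian G d).mulVec v := by
  have hd' : (0 : ℝ) < d := by exact_mod_cast hd
  obtain ⟨c, hc⟩ := hC.exists_label
  have h1 : ∑ i, ∑ x ∈ C i, ∑ y ∈ C i, edgeWeight G x y * (v x - v y) ^ 2 ≤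
      ∑ x, ∑ y, edgeWeight G x y * (v x - v y) ^ 2 := by
    rw [sum_eq_sum_clusters hc]
    refine Finset.sum_le_sum fun i _ => Finset.sum_le_sum fun x _ => ?_
    exact Finset.sum_le_sum_of_subset_of_nonneg (Finset.subset_univ _)
      fun y _ _ => mul_nonneg (edgeWeight_nonneg G x y) (sq_nonneg _)
  have h2 := Finset.sum_le_sum fun i (_ : i ∈ Finset.univ) =>
    cheeger_variance (edgeWeight G) (edgeWeight_symm G) (edgeWeight_nonneg G) (C i) φ d hφ hd'
      (sum_edgeWeight_le hG (C i)) (fun S hS hne hcard =>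
        le_cut_of_le_internalConductance G hd (hC.internal i) hS hne hcard) v
  rw [← Finset.mul_sum] at h2
  rw [laplacian_quadratic_form hd hG, div_mul_eq_mul_div, one_div_mul_eq_div,
    div_le_div_iff₀ (by norm_num) (by positivity)]
  linarith

theorem laplacian_le_of_blockwise_const (hd : 0 < d) (hG : G.IsRegularOfDegree d)
    (hC : IsClustering G d φ ε β C) {c : V → Fin k} (hc : ∀ x i, x ∈ C i ↔ c x = i)
    (a : Fin k → ℝ) :
    (fun x => a (c x)) ⬝ᵥ (normalizedLaplacian G d).mulVec (fun x => a (c x)) ≤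
      2 * ε * ∑ x, a (c x) ^ 2 := by
  have hd' : (0 : ℝ) < d := by exact_mod_cast hd
  let b : V → V → ℝ := fun x y => if c x = c y then 0 else edgeWeight G x y
  have hb : ∀ x y, b x y = b y x := fun x y => by
    simp only [b, eq_comm (a := c x), edgeWeight_symm G x y]
  have h1 : ∑ x, ∑ y, b x y * a (c x) ^ 2 ≤ ε * d * ∑ x, a (c x) ^ 2 := by
    rw [sum_eq_sum_clusters hc, sum_eq_sum_clusters hc, Finset.mul_sum]
    refine Finset.sum_le_sum fun i _ => ?_
    have h2 := cut_le_of_outerConductance_le G hd (hC.nonempty i) (hC.outer i)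
    have h3 : ∑ x ∈ C i, ∑ y, b x y * a (c x) ^ 2 =
        (∑ x ∈ C i, ∑ y ∈ (C i)ᶜ, edgeWeight G x y) * a i ^ 2 := by
      rw [Finset.sum_mul]
      refine Finset.sum_congr rfl fun x hx => ?_
      rw [← Finset.sum_mul, (hc x i).1 hx]
      congr 1
      rw [← Finset.sum_add_sum_compl (C i)]
      rw [Finset.sum_eq_zero fun y hy => by simp [b, (hc x i).1 hx, (hc y i).1 hy], zero_add]
      refine Finset.sum_congr rfl fun y hy => ?_
      rw [Finset.mem_compl, hc] at hy
      simp [b, (hc x i).1 hx, Ne.symm hy]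
    have h4 : ∑ x ∈ C i, a (c x) ^ 2 = (C i).card * a i ^ 2 := by
      rw [Finset.sum_congr rfl fun x hx => by rw [(hc x i).1 hx], Finset.sum_const, nsmul_eq_mul]
    rw [h3, h4]
    nlinarith [mul_le_mul_of_nonneg_right h2 (sq_nonneg (a i))]
  have h5 : ∑ x, ∑ y, b x y * a (c y) ^ 2 = ∑ x, ∑ y, b x y * a (c x) ^ 2 := by
    rw [Finset.sum_comm]
    exact Finset.sum_congr rfl fun x _ => Finset.sum_congr rfl fun y _ => by rw [hb]
  have h6 : ∑ x, ∑ y, edgeWeight G x y * (a (c x) - a (c y)) ^ 2 ≤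
      ∑ x, ∑ y, (2 * (b x y * a (c x) ^ 2) + 2 * (b x y * a (c y) ^ 2)) := by
    refine Finset.sum_le_sum fun x _ => Finset.sum_le_sum fun y _ => ?_
    by_cases hxy : c x = c y
    · simp [b, hxy]
    · simp only [b, hxy, if_false]
      nlinarith [mul_nonneg (edgeWeight_nonneg G x y) (sq_nonneg (a (c x) + a (c y)))]
  simp only [Finset.sum_add_distrib, ← Finset.mul_sum, h5] at h6
  rw [laplacian_quadratic_form hd hG, one_div_mul_eq_div, div_le_iff₀ (by positivity)]
  linarith

end Laplacian

/-! ### The spectral embedding -/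

section Embedding

variable {V : Type*} [Fintype V] [DecidableEq V] {G : SimpleGraph V} [DecidableRel G.Adj] {d : ℕ}
  {k : ℕ} {φ ε β : ℝ} {C : Fin k → Finset V}

theorem laplacian_form_eq_sum {ι : Type*} [Fintype ι]
    (u : OrthonormalBasis ι ℝ (EuclideanSpace ℝ V)) (lam : ι → ℝ)
    (hu : ∀ i, (normalizedLaplacian G d).mulVec (u i).ofLp = lam i • (u i).ofLp)
    (z : EuclideanSpace ℝ V) :
    z.ofLp ⬝ᵥ (normalizedLaplacian G d).mulVec z.ofLp = ∑ i, lam i * ⟪u i, z⟫_ℝ ^ 2 := by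
  set y : EuclideanSpace ℝ V := WithLp.toLp 2 ((normalizedLaplacian G d).mulVec z.ofLp) with hy
  have h1 : z.ofLp ⬝ᵥ (normalizedLaplacian G d).mulVec z.ofLp = ⟪z, y⟫_ℝ := by
    rw [EuclideanSpace.inner_eq_star_dotProduct, dotProduct_comm]
    simp [hy]
  rw [h1, ← u.sum_inner_mul_inner]
  refine Finset.sum_congr rfl fun i _ => ?_
  have h2 : ⟪u i, y⟫_ℝ = lam i * ⟪u i, z⟫_ℝ := by
    simp only [EuclideanSpace.inner_eq_star_dotProduct, star_trivial, hy]
    rw [dotProduct_comm, normalizedLaplacian_symm_form, hu, smul_dotProduct, smul_eq_mul,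
      dotProduct_comm]
  rw [h2, real_inner_comm]
  ring

/-- The easy half of the Courant–Fischer principle: the `k`-dimensional space of functions that
are constant on the clusters meets the orthogonal complement of the first `k - 1` eigenvectors. -/
theorem eigenvalue_le (hd : 0 < d) (hG : G.IsRegularOfDegree d)
    (hC : IsClustering G d φ ε β C) (hk : k ≤ Fintype.card V)
    (u : OrthonormalBasis (Fin (Fintype.card V)) ℝ (EuclideanSpace ℝ V))
    (lam : Fin (Fintype.card V) → ℝ) (hmono : Monotone lam)
    (hu : ∀ i, (normalizedLaplacian G d).mulVec (u i).ofLp = lam i • (u i).ofLp)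
    (j : Fin k) : lam (Fin.castLE hk j) ≤ 2 * ε := by
  obtain ⟨c, hc⟩ := hC.exists_label
  let Φ : (Fin k → ℝ) →ₗ[ℝ] EuclideanSpace ℝ V :=
    (WithLp.linearEquiv 2 ℝ (V → ℝ)).symm.toLinearMap ∘ₗ LinearMap.funLeft ℝ ℝ c
  have hΦ : ∀ a x, Φ a x = a (c x) := fun a x => rfl
  let Ψ : (Fin k → ℝ) →ₗ[ℝ] (Fin j → ℝ) :=
    LinearMap.pi fun l => (innerₛₗ ℝ (u (Fin.castLE (j.2.le.trans hk) l))) ∘ₗ Φ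
  have hker : LinearMap.ker Ψ ≠ ⊥ := LinearMap.ker_ne_bot_of_finrank_lt (by simp)
  obtain ⟨a, haker, ha0⟩ := Submodule.exists_mem_ne_zero_of_ne_bot hker
  have horth : ∀ i, i < Fin.castLE hk j → ⟪u i, Φ a⟫_ℝ = 0 := fun i hi =>
    congrFun (LinearMap.mem_ker.1 haker) ⟨i, hi⟩
  have hnorm : ∑ x, a (c x) ^ 2 = ∑ i, ⟪u i, Φ a⟫_ℝ ^ 2 := by
    have := u.sum_sq_norm_inner_right (Φ a)
    simp only [Real.norm_eq_abs, sq_abs] at this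
    rw [this, EuclideanSpace.norm_sq_eq]
    simp [hΦ]
  have hpos : 0 < ∑ x, a (c x) ^ 2 := by
    obtain ⟨i, hi⟩ := Function.ne_iff.1 ha0
    obtain ⟨x, hx⟩ := hC.nonempty i
    refine Finset.sum_pos' (fun x _ => sq_nonneg _) ⟨x, Finset.mem_univ _, ?_⟩
    rw [(hc x i).1 hx]
    exact sq_pos_of_ne_zero hi
  have h1 := laplacian_le_of_blockwise_const hd hG hC hc a
  have h2 := laplacian_form_eq_sum u lam hu (Φ a)
  have h3 : lam (Fin.castLE hk j) * ∑ i, ⟪u i, Φ a⟫_ℝ ^ 2 ≤ ∑ i, lam i * ⟪u i, Φ a⟫_ℝ ^ 2 := by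
    rw [Finset.mul_sum]
    refine Finset.sum_le_sum fun i _ => ?_
    rcases lt_or_ge i (Fin.castLE hk j) with hi | hi
    · simp [horth i hi]
    · exact mul_le_mul_of_nonneg_right (hmono hi) (sq_nonneg _)
  rw [← h2, ← hnorm] at h3
  exact le_of_mul_le_mul_right (h3.trans h1) hpos

/-- The two facts about the spectral embedding that the analysis rests on: it is isotropic, and in
every direction its total variance around the cluster means is at most `4 ε / φ²`. -/
theorem IsSpectralEmbedding.isotropic_and_variance_le {f : V → EuclideanSpace ℝ (Fin k)}
    (hf : IsSpectralEmbedding G d f) (hd : 0 < d) (hG : G.IsRegularOfDegree d) (hφ : 0 < φ)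
    (hC : IsClustering G d φ ε β C) (α : EuclideanSpace ℝ (Fin k)) :
    ∑ x, ⟪f x, α⟫_ℝ ^ 2 = ‖α‖ ^ 2 ∧
      ∑ i, ∑ x ∈ C i, ⟪f x - clusterMean f C i, α⟫_ℝ ^ 2 ≤ 4 * (ε / φ ^ 2) * ‖α‖ ^ 2 := by
  obtain ⟨hk, u, lam, hmono, hu, hfu⟩ := hf
  let z : EuclideanSpace ℝ V := ∑ j, α j • u (Fin.castLE hk j)
  have hz : ∀ x, z x = ⟪f x, α⟫_ℝ := fun x => by
    simp only [z, WithLp.ofLp_sum, WithLp.ofLp_smul, Finset.sum_apply, Pi.smul_apply, smul_eq_mul,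
      PiLp.inner_apply, hfu]
    exact Finset.sum_congr rfl fun j _ => by simp
  have hon : Orthonormal ℝ fun j => u (Fin.castLE hk j) :=
    u.orthonormal.comp _ (Fin.castLE_injective hk)
  have hznorm : ‖z‖ ^ 2 = ‖α‖ ^ 2 := by
    rw [← real_inner_self_eq_norm_sq, hon.inner_sum, EuclideanSpace.norm_sq_eq]
    simp [sq]
  have hisot : ∑ x, ⟪f x, α⟫_ℝ ^ 2 = ‖α‖ ^ 2 := by
    rw [← hznorm, EuclideanSpace.norm_sq_eq]
    simp [hz]
  refine ⟨hisot, ?_⟩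
  have h1 : z.ofLp ⬝ᵥ (normalizedLaplacian G d).mulVec z.ofLp ≤ 2 * ε * ‖α‖ ^ 2 := by
    rw [laplacian_form_eq_sum u lam hu, ← hznorm, ← u.sum_sq_norm_inner_right z, Finset.mul_sum]
    refine Finset.sum_le_sum fun i _ => ?_
    rw [Real.norm_eq_abs, sq_abs]
    by_cases hi : (i : ℕ) < k
    · exact mul_le_mul_of_nonneg_right
        (eigenvalue_le hd hG hC hk u lam hmono hu ⟨i, hi⟩) (sq_nonneg _)
    · have h0 : ⟪u i, z⟫_ℝ = 0 := by
        simp only [z, inner_sum, inner_smul_right]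
        refine Finset.sum_eq_zero fun j _ => ?_
        rw [u.inner_eq_zero (fun h => hi (by rw [h]; exact j.2)), mul_zero]
      simp [h0]
  have h2 := variance_le_laplacian hd hG hφ hC z.ofLp
  have h3 : ∀ i, ∀ x ∈ C i, ⟪f x - clusterMean f C i, α⟫_ℝ =
      z x - (1 / ((C i).card : ℝ)) * ∑ y ∈ C i, z y := fun i x _ => by
    simp only [clusterMean, inner_sub_left, real_inner_smul_left, sum_inner, hz]
  rw [Finset.sum_congr rfl fun i _ => Finset.sum_congr rfl fun x hx => by rw [h3 i x hx]]
  have h4 := h2.trans h1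
  have hφ2 : 0 < φ ^ 2 := by positivity
  rw [show 4 * (ε / φ ^ 2) * ‖α‖ ^ 2 = (2 * (2 * ε * ‖α‖ ^ 2)) / φ ^ 2 by ring,
    le_div_iff₀ hφ2]
  linarith

end Embedding

/-! ### Geometry of the cluster means -/

section Frame

variable {k : ℕ} {μ : Fin k → EuclideanSpace ℝ (Fin k)} {m : Fin k → ℝ} {δ : ℝ}

theorem norm_sq_linearCombination_le (hm : ∀ i, 0 < m i)
    (hup : ∀ α, ∑ i, m i * ⟪μ i, α⟫_ℝ ^ 2 ≤ ‖α‖ ^ 2) (b : Fin k → ℝ) :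
    ‖∑ i, b i • μ i‖ ^ 2 ≤ ∑ i, b i ^ 2 / m i := by
  set y := ∑ i, b i • μ i with hy
  have h1 : ‖y‖ ^ 2 = ∑ i, b i * ⟪μ i, y⟫_ℝ := by
    rw [← real_inner_self_eq_norm_sq]
    nth_rw 1 [hy]
    simp only [sum_inner, real_inner_smul_left]
  have h2 : ∑ i, 2 * (b i * ⟪μ i, y⟫_ℝ) ≤ ∑ i, (b i ^ 2 / m i + m i * ⟪μ i, y⟫_ℝ ^ 2) := by
    refine Finset.sum_le_sum fun i _ => ?_
    have h3 : 0 ≤ (b i - m i * ⟪μ i, y⟫_ℝ) ^ 2 / m i := div_nonneg (sq_nonneg _) (hm i).le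
    have h4 : (b i - m i * ⟪μ i, y⟫_ℝ) ^ 2 / m i =
        b i ^ 2 / m i - 2 * (b i * ⟪μ i, y⟫_ℝ) + m i * ⟪μ i, y⟫_ℝ ^ 2 := by
      have := (hm i).ne'
      field_simp
      ring
    linarith
  rw [← Finset.mul_sum, ← h1, Finset.sum_add_distrib] at h2
  linarith [hup y]

/-- The number of vectors equals the dimension, so a lower frame bound for the `μ i` is also a
lower bound for the norms of their linear combinations. -/
theorem le_norm_sq_linearCombination (hm : ∀ i, 0 < m i) (hδ : δ < 1)
    (hlow : ∀ α, (1 - δ) * ‖α‖ ^ 2 ≤ ∑ i, m i * ⟪μ i, α⟫_ℝ ^ 2) (b : Fin k → ℝ) :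
    (1 - δ) * ∑ i, b i ^ 2 / m i ≤ ‖∑ i, b i • μ i‖ ^ 2 := by
  let T : EuclideanSpace ℝ (Fin k) →ₗ[ℝ] (Fin k → ℝ) :=
    LinearMap.pi fun i => innerₛₗ ℝ (μ i)
  have hT : ∀ α i, T α i = ⟪μ i, α⟫_ℝ := fun α i => rfl
  have hinj : Function.Injective T := by
    rw [← LinearMap.ker_eq_bot, LinearMap.ker_eq_bot']
    intro α hα
    have h1 := hlow α
    rw [Finset.sum_eq_zero fun i _ => by rw [← hT, hα]; simp] at h1
    have h2 : ‖α‖ ^ 2 ≤ 0 := by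
      by_contra h
      nlinarith [mul_pos (sub_pos.2 hδ) (not_le.1 h)]
    simpa using le_antisymm h2 (sq_nonneg _)
  have hsurj : Function.Surjective T :=
    (LinearMap.injective_iff_surjective_of_finrank_eq_finrank (by simp)).1 hinj
  obtain ⟨α, hα⟩ := hsurj fun i => b i / m i
  have hα' : ∀ i, ⟪μ i, α⟫_ℝ = b i / m i := fun i => by rw [← hT, hα]
  set y := ∑ i, b i • μ i with hy
  set s := ∑ i, b i ^ 2 / m i with hs
  have hs0 : 0 ≤ s := Finset.sum_nonneg fun i _ => div_nonneg (sq_nonneg _) (hm i).le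
  have h1 : (1 - δ) * ‖α‖ ^ 2 ≤ s := by
    refine (hlow α).trans_eq (Finset.sum_congr rfl fun i _ => ?_)
    rw [hα']
    have := (hm i).ne'
    field_simp
  have h2 : ⟪y, α⟫_ℝ = s := by
    simp only [hy, sum_inner, real_inner_smul_left, hα', hs]
    exact Finset.sum_congr rfl fun i _ => by ring
  have h3 : s ^ 2 ≤ ‖y‖ ^ 2 * ‖α‖ ^ 2 := by
    rw [← mul_pow, ← h2]
    exact sq_le_sq' (by linarith [neg_abs_le ⟪y, α⟫_ℝ, abs_real_inner_le_norm y α])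
      (real_inner_le_norm y α)
  rcases hs0.eq_or_lt with h0 | hpos
  · rw [← h0, mul_zero]; positivity
  · have h4 : (1 - δ) * s ^ 2 ≤ ‖y‖ ^ 2 * s := by
      calc (1 - δ) * s ^ 2 ≤ (1 - δ) * (‖y‖ ^ 2 * ‖α‖ ^ 2) :=
            mul_le_mul_of_nonneg_left h3 (sub_nonneg.2 hδ.le)
        _ = ‖y‖ ^ 2 * ((1 - δ) * ‖α‖ ^ 2) := by ring
        _ ≤ ‖y‖ ^ 2 * s := mul_le_mul_of_nonneg_left h1 (sq_nonneg _)
    refine le_of_mul_le_mul_right ?_ hpos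
    linarith

theorem projCenter_eq_zero {P : Finset (Fin k)} {i : Fin k} (hi : i ∈ P) :
    projCenter μ P i = 0 := by
  rw [projCenter, Submodule.starProjection_orthogonal_apply_eq_zero]
  exact Submodule.subset_span ⟨i, by simpa using hi, rfl⟩

theorem inner_projCenter (P : Finset (Fin k)) (i j : Fin k) :
    ⟪μ j, projCenter μ P i⟫_ℝ = ⟪projCenter μ P j, projCenter μ P i⟫_ℝ := by
  simp only [projCenter]
  rw [Submodule.inner_starProjection_left_eq_right,
    Submodule.starProjection_eq_self_iff.2 (Submodule.starProjection_apply_mem _ _)]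

theorem exists_projCenter_eq (P : Finset (Fin k)) (i : Fin k) :
    ∃ b : Fin k → ℝ, (∀ l ∉ P, b l = 0) ∧ projCenter μ P i = μ i - ∑ l, b l • μ l := by
  have h1 : projCenter μ P i =
      μ i - (Submodule.span ℝ (μ '' (P : Set (Fin k)))).starProjection (μ i) := by
    rw [projCenter, Submodule.starProjection_orthogonal']
    simp
  have h2 := Submodule.starProjection_apply_mem (Submodule.span ℝ (μ '' (P : Set (Fin k)))) (μ i)
  obtain ⟨b, hb⟩ := (Submodule.mem_span_image_finset_iff_exists_fun ℝ).1 h2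
  refine ⟨fun l => if h : l ∈ P then b ⟨l, h⟩ else 0, fun l hl => by simp [hl], ?_⟩
  rw [h1, ← hb, ← Finset.sum_subset (Finset.subset_univ P) fun l _ hl => by simp [hl],
    ← Finset.sum_attach P]
  simp

theorem le_norm_sq_projCenter (hm : ∀ i, 0 < m i) (hδ : δ < 1)
    (hlow : ∀ α, (1 - δ) * ‖α‖ ^ 2 ≤ ∑ i, m i * ⟪μ i, α⟫_ℝ ^ 2) {P : Finset (Fin k)}
    {i : Fin k} (hi : i ∉ P) : (1 - δ) / m i ≤ ‖projCenter μ P i‖ ^ 2 := by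
  obtain ⟨b, hb, he⟩ := exists_projCenter_eq (μ := μ) P i
  have h1 := le_norm_sq_linearCombination hm hδ hlow ((Pi.single i 1 : Fin k → ℝ) - b)
  have h2 : ∑ l, ((Pi.single i 1 : Fin k → ℝ) - b) l • μ l = projCenter μ P i := by
    simp [he, sub_smul, Pi.single_apply]
  rw [h2] at h1
  refine le_trans ?_ h1
  rw [div_eq_mul_one_div]
  refine mul_le_mul_of_nonneg_left ?_ (sub_nonneg.2 hδ.le)
  refine le_trans ?_ (Finset.single_le_sum
    (fun l _ => div_nonneg (sq_nonneg _) (hm l).le) (Finset.mem_univ i))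
  simp [hb i hi]

theorem norm_projCenter_add_le (P : Finset (Fin k)) (i j : Fin k) :
    ‖projCenter μ P i + projCenter μ P j‖ ≤ ‖μ i + μ j‖ := by
  simp only [projCenter, ← map_add]
  exact Submodule.norm_starProjection_apply_le _ _

theorem norm_add_sq_le (hm : ∀ i, 0 < m i)
    (hup : ∀ α, ∑ i, m i * ⟪μ i, α⟫_ℝ ^ 2 ≤ ‖α‖ ^ 2) {i j : Fin k} (hij : i ≠ j) :
    ‖μ i + μ j‖ ^ 2 ≤ 1 / m i + 1 / m j := by
  have h1 := norm_sq_linearCombination_le hm hup (fun l => if l = i ∨ l = j then 1 else 0)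
  have h2 : ∀ F : Fin k → ℝ, ∑ l, (if l = i ∨ l = j then F l else 0) = F i + F j := fun F => by
    rw [← Finset.sum_pair hij, ← Finset.sum_filter]
    congr 1
    ext l
    simp
  have h3 : ∑ l, (if l = i ∨ l = j then (1 : ℝ) else 0) • μ l = μ i + μ j := by
    rw [← Finset.sum_pair hij]
    simp only [ite_smul, one_smul, zero_smul]
    rw [← Finset.sum_filter]
    congr 1
    ext l
    simp
  rw [h3] at h1
  rw [← h2 fun l => 1 / m l]
  refine h1.trans_eq (Finset.sum_congr rfl fun l _ => ?_)
  split_ifs <;> simp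

/-- Polarization: the projected centers keep almost all of their length, and the norm of the sum
of two of them does not grow, which leaves no room for a large inner product. -/
theorem inner_projCenter_le (hm : ∀ i, 0 < m i) (hδ0 : 0 ≤ δ) (hδ : δ < 1)
    (hlow : ∀ α, (1 - δ) * ‖α‖ ^ 2 ≤ ∑ i, m i * ⟪μ i, α⟫_ℝ ^ 2)
    (hup : ∀ α, ∑ i, m i * ⟪μ i, α⟫_ℝ ^ 2 ≤ ‖α‖ ^ 2) {P : Finset (Fin k)} {i j : Fin k}
    (hi : i ∉ P) (hij : i ≠ j) :
    2 * ⟪μ j, projCenter μ P i⟫_ℝ ≤ δ * (1 / m i + 1 / m j) := by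
  rw [inner_projCenter]
  by_cases hj : j ∈ P
  · rw [projCenter_eq_zero hj]
    have := hm i
    have := hm j
    simp only [inner_zero_left, mul_zero]
    positivity
  have h1 := le_norm_sq_projCenter hm hδ hlow hi
  have h2 := le_norm_sq_projCenter hm hδ hlow hj
  have h3 := pow_le_pow_left₀ (norm_nonneg _) (norm_projCenter_add_le (μ := μ) P i j) 2
  have h4 := norm_add_sq_le hm hup hij
  rw [norm_add_sq_real, real_inner_comm] at h3
  rw [div_eq_mul_one_div] at h1 h2
  linarith

theorem center_injective (hm : ∀ i, 0 < m i) (hδ : δ < 1)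
    (hlow : ∀ α, (1 - δ) * ‖α‖ ^ 2 ≤ ∑ i, m i * ⟪μ i, α⟫_ℝ ^ 2) : Function.Injective μ := by
  intro i j hij
  by_contra hne
  have h1 := le_norm_sq_projCenter hm hδ hlow (P := {j}) (i := i) (by simpa using hne)
  have h2 : projCenter μ {j} i = 0 := by
    have := projCenter_eq_zero (μ := μ) (Finset.mem_singleton_self j)
    rwa [projCenter, ← hij] at this
  rw [h2] at h1
  have h3 := div_pos (sub_pos.2 hδ) (hm i)
  simp at h1
  linarith

end Frame

/-! ### Threshold sets approximate clusters -/

theorem sum_inner_sq_cluster {V : Type*} {k : ℕ} {f : V → EuclideanSpace ℝ (Fin k)}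
    {C : Fin k → Finset V} (hne : ∀ i, (C i).Nonempty) (α : EuclideanSpace ℝ (Fin k))
    (i : Fin k) :
    ∑ x ∈ C i, ⟪f x, α⟫_ℝ ^ 2 = ∑ x ∈ C i, ⟪f x - clusterMean f C i, α⟫_ℝ ^ 2 +
      (C i).card * ⟪clusterMean f C i, α⟫_ℝ ^ 2 := by
  have hc : ((C i).card : ℝ) ≠ 0 := by exact_mod_cast (hne i).card_pos.ne'
  set a := ⟪clusterMean f C i, α⟫_ℝ with ha
  have hs : ∑ x ∈ C i, ⟪f x, α⟫_ℝ = (C i).card * a := by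
    rw [ha, clusterMean, real_inner_smul_left, sum_inner]
    field_simp
  have h1 : ∀ x ∈ C i, ⟪f x, α⟫_ℝ ^ 2 = ⟪f x - clusterMean f C i, α⟫_ℝ ^ 2 +
      (2 * a * ⟪f x, α⟫_ℝ - a ^ 2) := fun x _ => by
    rw [inner_sub_left, ← ha]; ring
  rw [Finset.sum_congr rfl h1, Finset.sum_add_distrib, Finset.sum_sub_distrib, ← Finset.mul_sum, hs,
    Finset.sum_const, nsmul_eq_mul]
  ring

theorem frame_bounds {V : Type*} [Fintype V] {k : ℕ} {f : V → EuclideanSpace ℝ (Fin k)}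
    {C : Fin k → Finset V} {δ : ℝ} {c : V → Fin k} (hc : ∀ x i, x ∈ C i ↔ c x = i)
    (hne : ∀ i, (C i).Nonempty)
    (hiso : ∀ α, ∑ x, ⟪f x, α⟫_ℝ ^ 2 = ‖α‖ ^ 2)
    (hvar : ∀ α, ∑ i, ∑ x ∈ C i, ⟪f x - clusterMean f C i, α⟫_ℝ ^ 2 ≤ δ * ‖α‖ ^ 2)
    (α : EuclideanSpace ℝ (Fin k)) :
    (1 - δ) * ‖α‖ ^ 2 ≤ ∑ i, ((C i).card : ℝ) * ⟪clusterMean f C i, α⟫_ℝ ^ 2 ∧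
      ∑ i, ((C i).card : ℝ) * ⟪clusterMean f C i, α⟫_ℝ ^ 2 ≤ ‖α‖ ^ 2 := by
  have h1 := hiso α
  rw [sum_eq_sum_clusters hc, Finset.sum_congr rfl fun i _ => sum_inner_sq_cluster hne α i,
    Finset.sum_add_distrib] at h1
  have h2 := hvar α
  have h3 : 0 ≤ ∑ i, ∑ x ∈ C i, ⟪f x - clusterMean f C i, α⟫_ℝ ^ 2 :=
    Finset.sum_nonneg fun i _ => Finset.sum_nonneg fun x _ => sq_nonneg _
  constructor <;> linarith

section Threshold

variable {V : Type*} [Fintype V] [DecidableEq V] {k : ℕ} {f : V → EuclideanSpace ℝ (Fin k)}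
  {C : Fin k → Finset V} {δ β : ℝ}

/-- A vertex on the wrong side of the threshold lies at distance at least `0.07 ‖y‖` from its
cluster mean in the direction of the projected center `y`; by Markov's inequality and the variance
bound there are few of those. -/
theorem card_symmDiff_thresholdSet_le {c : V → Fin k} (hc : ∀ x i, x ∈ C i ↔ c x = i)
    (hne : ∀ i, (C i).Nonempty)
    (hiso : ∀ α, ∑ x, ⟪f x, α⟫_ℝ ^ 2 = ‖α‖ ^ 2)
    (hvar : ∀ α, ∑ i, ∑ x ∈ C i, ⟪f x - clusterMean f C i, α⟫_ℝ ^ 2 ≤ δ * ‖α‖ ^ 2)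
    (hbal : ∀ i j, ((C i).card : ℝ) ≤ β * (C j).card) (hδ0 : 0 ≤ δ) (hδ : δ * (1 + β) ≤ 1 / 4)
    {P : Finset (Fin k)} {i : Fin k} (hi : i ∉ P) :
    ((symmDiff (thresholdSet f (projCenter (clusterMean f C) P i) 0.93) (C i)).card : ℝ) ≤
      250 * δ * (C i).card := by
  have hm : ∀ j, (0 : ℝ) < (C j).card := fun j => by exact_mod_cast (hne j).card_pos
  have hβ : 1 ≤ β := by
    by_contra h
    nlinarith [hbal i i, hm i]
  have hδ8 : δ ≤ 1 / 8 := by nlinarith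
  have hfr := frame_bounds hc hne hiso hvar
  set μ := clusterMean f C with hμ
  set y := projCenter μ P i with hy
  have hylow := le_norm_sq_projCenter hm (by linarith) (fun α => (hfr α).1) hi
  rw [← hy] at hylow
  have hy78 : 7 / 8 ≤ ‖y‖ ^ 2 * (C i).card := by
    rw [div_le_iff₀ (hm i)] at hylow
    linarith
  have hypos : 0 < ‖y‖ ^ 2 := by
    by_contra h
    nlinarith [hm i]
  have hself : ⟪μ i, y⟫_ℝ = ‖y‖ ^ 2 := by
    rw [hy, inner_projCenter, real_inner_self_eq_norm_sq]
  have hcross : ∀ j, i ≠ j → ⟪μ j, y⟫_ℝ ≤ 1 / 7 * ‖y‖ ^ 2 := fun j hij => by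
    have h1 := inner_projCenter_le hm hδ0 (by linarith) (fun α => (hfr α).1)
      (fun α => (hfr α).2) hi hij
    have h2 : 1 / ((C j).card : ℝ) ≤ β * (1 / (C i).card) := by
      rw [mul_one_div, div_le_div_iff₀ (hm j) (hm i)]
      linarith [hbal i j]
    have h3 : δ * (1 / ((C i).card : ℝ) + 1 / (C j).card) ≤ 1 / 4 * (1 / (C i).card) := by
      calc _ ≤ δ * (1 / ((C i).card : ℝ) + β * (1 / (C i).card)) := by gcongr
        _ = δ * (1 + β) * (1 / (C i).card) := by ring
        _ ≤ _ := by gcongr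
    have h4 : 1 / ((C i).card : ℝ) ≤ 8 / 7 * ‖y‖ ^ 2 := by
      rw [div_le_iff₀ (hm i)]; linarith
    linarith
  set D := symmDiff (thresholdSet f y 0.93) (C i) with hD
  have hfar : ∀ x ∈ D, (0.07 * ‖y‖ ^ 2) ^ 2 ≤ ⟪f x - μ (c x), y⟫_ℝ ^ 2 := by
    intro x hx
    rw [hD, Finset.mem_symmDiff, thresholdSet, Finset.mem_filter, hc] at hx
    rw [inner_sub_left]
    rcases hx with ⟨⟨_, h1⟩, h2⟩ | ⟨h2, h1⟩
    · exact pow_le_pow_left₀ (by positivity) (by linarith [hcross (c x) (Ne.symm h2)]) 2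
    · simp only [Finset.mem_univ, true_and, not_le] at h1
      rw [h2, hself, ← neg_sq (⟪f x, y⟫_ℝ - _)]
      exact pow_le_pow_left₀ (by positivity) (by linarith) 2
  have hsum : D.card * (0.07 * ‖y‖ ^ 2) ^ 2 ≤ δ * ‖y‖ ^ 2 := by
    calc D.card * (0.07 * ‖y‖ ^ 2) ^ 2 = ∑ x ∈ D, (0.07 * ‖y‖ ^ 2) ^ 2 := by simp
      _ ≤ ∑ x ∈ D, ⟪f x - μ (c x), y⟫_ℝ ^ 2 := Finset.sum_le_sum hfar
      _ ≤ ∑ x, ⟪f x - μ (c x), y⟫_ℝ ^ 2 :=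
        Finset.sum_le_sum_of_subset_of_nonneg (Finset.subset_univ _) fun _ _ _ => sq_nonneg _
      _ = ∑ j, ∑ x ∈ C j, ⟪f x - μ j, y⟫_ℝ ^ 2 := by
        rw [sum_eq_sum_clusters hc]
        exact Finset.sum_congr rfl fun j _ => Finset.sum_congr rfl fun x hx => by
          rw [(hc x j).1 hx]
      _ ≤ δ * ‖y‖ ^ 2 := hvar y
  have h5 : (D.card : ℝ) * (0.0049 * ‖y‖ ^ 2) ≤ δ := by
    refine le_of_mul_le_mul_right ?_ hypos
    calc _ = D.card * (0.07 * ‖y‖ ^ 2) ^ 2 := by ring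
      _ ≤ _ := hsum
  have h6 : (D.card : ℝ) * (0.0049 * (7 / 8)) ≤ D.card * (0.0049 * (‖y‖ ^ 2 * (C i).card)) := by
    gcongr
  have h7 := mul_le_mul_of_nonneg_right h5 (hm i).le
  have h8 : 0 ≤ δ * (C i).card := by have := hm i; positivity
  nlinarith

end Threshold

/-! ### Sets close to a cluster, and sets of small conductance -/

section Cuts

variable {V : Type*} [Fintype V] [DecidableEq V] {G : SimpleGraph V} [DecidableRel G.Adj] {d : ℕ}

theorem cut_le_cut_add (hG : G.IsRegularOfDegree d) (C D : Finset V) :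
    ∑ x ∈ D, ∑ y ∈ Dᶜ, edgeWeight G x y ≤
      ∑ x ∈ C, ∑ y ∈ Cᶜ, edgeWeight G x y + d * (symmDiff D C).card := by
  have hrect : ∀ A B : Finset V, ∑ x ∈ A, ∑ y ∈ B, edgeWeight G x y =
      ∑ x, ∑ y, if x ∈ A ∧ y ∈ B then edgeWeight G x y else 0 := fun A B => by
    rw [← Finset.sum_product', ← Finset.sum_product', ← Finset.sum_filter]
    congr 1
    ext p
    simp
  have hrow : ∀ A : Finset V, ∑ x ∈ A, ∑ y, edgeWeight G x y = d * A.card := fun A => by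
    rw [Finset.sum_congr rfl fun x _ => sum_edgeWeight_univ hG x, Finset.sum_const, nsmul_eq_mul,
      mul_comm]
  have hcol : ∑ x, ∑ y ∈ C \ D, edgeWeight G x y = d * (C \ D).card := by
    rw [Finset.sum_comm, ← hrow]
    exact Finset.sum_congr rfl fun x _ => Finset.sum_congr rfl fun y _ => edgeWeight_symm G y x
  have hcard : ((symmDiff D C).card : ℝ) = (D \ C).card + (C \ D).card := by
    rw [symmDiff, Finset.sup_eq_union, Finset.card_union_of_disjoint disjoint_sdiff_sdiff]
    push_cast
    rfl
  rw [hcard, mul_add, ← hrow, ← hcol, hrect, hrect C, hrect (D \ C), hrect _ (C \ D)]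
  simp only [← Finset.sum_add_distrib]
  refine Finset.sum_le_sum fun x _ => Finset.sum_le_sum fun y _ => ?_
  have := edgeWeight_nonneg G x y
  by_cases h1 : x ∈ D <;> by_cases h2 : y ∈ D <;> by_cases h3 : x ∈ C <;>
    by_cases h4 : y ∈ C <;> simp [h1, h2, h3, h4, this]

theorem card_sdiff_le_card_symmDiff {V : Type*} [DecidableEq V] (C D : Finset V) :
    (C \ D).card ≤ (symmDiff D C).card :=
  Finset.card_le_card (le_sup_right : C \ D ≤ symmDiff D C)

theorem half_card_le_of_symmDiff_le {V : Type*} [DecidableEq V] {C D : Finset V} {ζ : ℝ}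
    (hζ : ζ ≤ 1 / 2)
    (h : ((symmDiff D C).card : ℝ) ≤ ζ * C.card) : (C.card : ℝ) / 2 ≤ D.card := by
  have h1 : C.card ≤ (C \ D).card + D.card := by
    have := Finset.card_sdiff_add_card_inter C D
    have := Finset.card_le_card (Finset.inter_subset_right : C ∩ D ⊆ D)
    omega
  have h2 := card_sdiff_le_card_symmDiff C D
  have h3 : (C.card : ℝ) ≤ (symmDiff D C).card + D.card := by exact_mod_cast (by omega)
  nlinarith [Nat.cast_nonneg (α := ℝ) C.card]

theorem outerConductance_le_of_symmDiff_le (hd : 0 < d) (hG : G.IsRegularOfDegree d)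
    {C D : Finset V} (hne : C.Nonempty) {ε ζ : ℝ} (hε : outerConductance G d C ≤ ε)
    (hε0 : 0 ≤ ε) (hζ0 : 0 ≤ ζ) (hζ : ζ ≤ 1 / 2) (h : ((symmDiff D C).card : ℝ) ≤ ζ * C.card) :
    outerConductance G d D ≤ 2 * (ε + ζ) := by
  have hd' : (0 : ℝ) < d := by exact_mod_cast hd
  have hC : (0 : ℝ) < C.card := by exact_mod_cast hne.card_pos
  have hD := half_card_le_of_symmDiff_le hζ h
  have h1 := cut_le_of_outerConductance_le G hd hne hε
  have h2 := cut_le_cut_add hG C D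
  rw [outerConductance_eq, div_le_iff₀ (mul_pos hd' (by linarith))]
  calc _ ≤ ε * d * C.card + d * (ζ * C.card) := by
        have := mul_le_mul_of_nonneg_left h hd'.le
        linarith
    _ = 2 * (ε + ζ) * (d * (C.card / 2)) := by ring
    _ ≤ _ := by gcongr

/-- A nonempty set `D` of conductance below `φ` that leaves `C i` in few vertices covers most of
`C i`: wherever `D` meets a cluster in at most half of it, at least `φ d` edges per vertex leave
`D`, so `D` cannot be of this kind in all clusters.  Only `C i` can be the exception, and then
`C i \ D` is the small side and expands. -/
theorem card_sdiff_le_of_outerConductance_le {k : ℕ} {φ ε β : ℝ} {C : Fin k → Finset V}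
    (hd : 0 < d) (hC : IsClustering G d φ ε β C)
    {b : ℝ} (hbal : ∀ i j, ((C i).card : ℝ) ≤ b * (C j).card) {D : Finset V} (hne : D.Nonempty)
    {i : Fin k} {η τ : ℝ} (hη0 : 0 ≤ η) (hη : η * b ≤ 1 / 2)
    (hD : ((D \ C i).card : ℝ) ≤ η * (C i).card)
    (hτ : outerConductance G d D ≤ τ) (hτφ : τ < φ) :
    φ * (C i \ D).card ≤ τ * D.card := by
  have hd' : (0 : ℝ) < d := by exact_mod_cast hd
  obtain ⟨c, hc⟩ := hC.exists_label
  have hcut := cut_le_of_outerConductance_le G hd hne hτ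
  have hsplit : ∀ F : V → ℝ, ∑ x ∈ D, F x = ∑ j, ∑ x ∈ D ∩ C j, F x := fun F => by
    rw [← Finset.sum_fiberwise D c F]
    refine Finset.sum_congr rfl fun j _ => Finset.sum_congr ?_ fun _ _ => rfl
    ext x
    simp [hc]
  have hpart : ∑ j, ∑ x ∈ D ∩ C j, ∑ y ∈ C j \ D, edgeWeight G x y ≤
      ∑ x ∈ D, ∑ y ∈ Dᶜ, edgeWeight G x y := by
    rw [hsplit]
    refine Finset.sum_le_sum fun j _ => Finset.sum_le_sum fun x _ =>
      Finset.sum_le_sum_of_subset_of_nonneg (fun y hy => ?_) fun y _ _ => edgeWeight_nonneg G x y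
    simp only [Finset.mem_sdiff] at hy
    simp [hy.2]
  have hnn : ∀ j, 0 ≤ ∑ x ∈ D ∩ C j, ∑ y ∈ C j \ D, edgeWeight G x y := fun j =>
    Finset.sum_nonneg fun x _ => Finset.sum_nonneg fun y _ => edgeWeight_nonneg G x y
  have hexp : ∀ j, 2 * (D ∩ C j).card ≤ (C j).card →
      φ * d * (D ∩ C j).card ≤ ∑ x ∈ D ∩ C j, ∑ y ∈ C j \ D, edgeWeight G x y := fun j hj => by
    rcases (D ∩ C j).eq_empty_or_nonempty with h0 | h0
    · simp [h0]
    · have := le_cut_of_le_internalConductance G hd (hC.internal j) Finset.inter_subset_right h0 hj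
      rwa [Finset.sdiff_inter_self_right] at this
  have hother : ∀ j, j ≠ i → 2 * (D ∩ C j).card ≤ (C j).card := fun j hj => by
    have h1 : D ∩ C j ⊆ D \ C i := fun x hx => by
      rw [Finset.mem_inter, hc] at hx
      rw [Finset.mem_sdiff, hc]
      exact ⟨hx.1, by rw [hx.2]; exact hj⟩
    have h2 : ((D ∩ C j).card : ℝ) ≤ (D \ C i).card := by exact_mod_cast Finset.card_le_card h1
    have h3 : (2 : ℝ) * (D ∩ C j).card ≤ (C j).card := by
      have h4 : η * (C i).card ≤ η * (b * (C j).card) := mul_le_mul_of_nonneg_left (hbal i j) hη0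
      nlinarith [Nat.cast_nonneg (α := ℝ) (C j).card]
    exact_mod_cast h3
  by_cases hi : 2 * (D ∩ C i).card ≤ (C i).card
  · exfalso
    have hall : ∀ j, 2 * (D ∩ C j).card ≤ (C j).card := fun j => by
      by_cases hj : j = i
      · rw [hj]; exact hi
      · exact hother j hj
    have h1 := (Finset.sum_le_sum fun j (_ : j ∈ Finset.univ) => hexp j (hall j)).trans
      (hpart.trans hcut)
    have h2 : (D.card : ℝ) = ∑ j, ((D ∩ C j).card : ℝ) := by simpa using hsplit fun _ => 1
    rw [← Finset.mul_sum, ← h2] at h1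
    have h3 : (0 : ℝ) < D.card := by exact_mod_cast hne.card_pos
    nlinarith [mul_pos (mul_pos (sub_pos.2 hτφ) hd') h3]
  · have hcard := Finset.card_sdiff_add_card_inter (C i) D
    rw [Finset.inter_comm] at hcard
    have h1 : φ * d * (C i \ D).card ≤ ∑ x ∈ D ∩ C i, ∑ y ∈ C i \ D, edgeWeight G x y := by
      rcases (C i \ D).eq_empty_or_nonempty with h0 | h0
      · simp [h0]
      · have := le_cut_of_le_internalConductance G hd (hC.internal i) Finset.sdiff_subset h0
          (by omega)
        rw [sdiff_sdiff_right_self, Finset.inf_eq_inter, Finset.inter_comm,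
          Finset.sum_comm] at this
        refine this.trans_eq (Finset.sum_congr rfl fun x _ => Finset.sum_congr rfl fun y _ => ?_)
        exact edgeWeight_symm G y x
    have h2 := Finset.single_le_sum (fun j _ => hnn j) (Finset.mem_univ i)
    have h3 : d * (φ * (C i \ D).card) ≤ d * (τ * D.card) := by linarith
    exact le_of_mul_le_mul_left h3 hd'

end Cuts

/-! ### The partitioning procedure -/

section Procedure

variable {V : Type*} [Fintype V] [DecidableEq V] {k : ℕ} {f : V → EuclideanSpace ℝ (Fin k)}
  {μ : Fin k → EuclideanSpace ℝ (Fin k)}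

theorem mem_exclusiveSet {P R : Finset (Fin k)} {i : Fin k} {x : V} :
    x ∈ exclusiveSet f μ P R i ↔ x ∈ thresholdSet f (projCenter μ P i) 0.93 ∧
      ∀ j ∈ R, j ≠ i → x ∉ thresholdSet f (projCenter μ P j) 0.93 := by
  simp only [exclusiveSet, Finset.mem_sdiff, Finset.mem_biUnion, Finset.mem_erase]
  constructor
  · exact fun h => ⟨h.1, fun j hj hji hx => h.2 ⟨j, ⟨hji, hj⟩, hx⟩⟩
  · exact fun h => ⟨h.1, fun ⟨j, hj, hx⟩ => h.2 j hj.2 hj.1 hx⟩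

theorem exclusiveSet_unique {P R : Finset (Fin k)} {i j : Fin k} {x : V}
    (hi : x ∈ exclusiveSet f μ P R i) (hj : x ∈ exclusiveSet f μ P R j) (hiR : i ∈ R) : i = j := by
  by_contra hne
  exact (mem_exclusiveSet.1 hj).2 i hiR hne (mem_exclusiveSet.1 hi).1

theorem mem_candidateCluster {i : Fin k} {L : List (Finset (Fin k))} {S : Finset (Fin k)} {x : V} :
    x ∈ candidateCluster f μ i L S ↔ IsInsideFrom f μ x i S ∅ L := by
  classical
  exact (Finset.mem_filter.trans (by simp [IsInside]))

theorem mem_inducedCluster {i : Fin k} {L : List (Finset (Fin k))} {x : V} :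
    x ∈ inducedCluster f μ L i ↔ hyperplanePartitioningFrom f μ x ∅ L = some i :=
  Finset.mem_filter.trans (by simp [hyperplanePartitioning])

theorem mem_unionOf {Ts : List (Finset (Fin k))} {i : Fin k} :
    i ∈ unionOf Ts ↔ ∃ T ∈ Ts, i ∈ T := by
  induction Ts with
  | nil => simp [unionOf]
  | cons T Ts ih =>
    have : unionOf (T :: Ts) = T ∪ unionOf Ts := rfl
    simp [this, ih]

theorem unionOf_append (L L' : List (Finset (Fin k))) :
    unionOf (L ++ L') = unionOf L ∪ unionOf L' := by
  ext i
  simp only [mem_unionOf, Finset.mem_union, List.mem_append, or_and_right, exists_or]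

theorem unionOf_cons (T : Finset (Fin k)) (L : List (Finset (Fin k))) :
    unionOf (T :: L) = T ∪ unionOf L := rfl

theorem mem_unionOf_of_hyperplanePartitioningFrom {x : V} {i : Fin k} :
    ∀ (Ts : List (Finset (Fin k))) (P : Finset (Fin k)),
      hyperplanePartitioningFrom f μ x P Ts = some i → i ∈ unionOf Ts := by
  intro Ts
  induction Ts with
  | nil => intro P h; simp [hyperplanePartitioningFrom] at h
  | cons T Ts ih =>
    intro P h
    rw [hyperplanePartitioningFrom] at h
    rw [unionOf_cons, Finset.mem_union]
    split at h
    · rename_i j hj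
      have := List.find?_some hj
      simp only [decide_eq_true_eq] at this
      rw [Option.some.injEq] at h
      exact Or.inl (h ▸ this.1)
    · exact Or.inr (ih _ h)

/-- A center `i` of the stage `T` is returned exactly if no stage of `L` returns a center and `x` is
in the exclusive set of `i`: within a stage at most one center qualifies, so the scanning order is
immaterial, and the later stages `L'` never return `i`. -/
theorem hyperplanePartitioningFrom_eq_some_iff {x : V} {i : Fin k} {T : Finset (Fin k)}
    {L' : List (Finset (Fin k))} (hiT : i ∈ T) (hiL' : i ∉ unionOf L') :
    ∀ (L : List (Finset (Fin k))) (P : Finset (Fin k)), i ∉ unionOf L →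
      (hyperplanePartitioningFrom f μ x P (L ++ T :: L') = some i ↔
        IsInsideFrom f μ x i (T ∪ unionOf L') P L) := by
  intro L
  induction L with
  | nil =>
    intro P _
    rw [List.nil_append, hyperplanePartitioningFrom, IsInsideFrom]
    split
    · rename_i j hj
      have hj' := List.find?_some hj
      simp only [decide_eq_true_eq] at hj'
      rw [Option.some.injEq]
      constructor
      · rintro rfl
        exact hj'.2
      · intro hi
        exact (exclusiveSet_unique hi hj'.2 (Finset.mem_union_left _ hiT)).symm
    · rename_i hnone
      constructor
      · exact fun h => absurd (mem_unionOf_of_hyperplanePartitioningFrom _ _ h) hiL'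
      · intro hi
        have := List.find?_eq_none.1 hnone i (List.mem_finRange i)
        simp [hiT, hi] at this
  | cons T₀ L ih =>
    intro P hi
    rw [unionOf_cons, Finset.mem_union, not_or] at hi
    rw [List.cons_append, hyperplanePartitioningFrom, IsInsideFrom, unionOf_append, unionOf_cons,
      ← Finset.union_assoc T₀]
    split
    · rename_i j hj
      have hj' := List.find?_some hj
      simp only [decide_eq_true_eq] at hj'
      rw [if_pos ⟨j, hj'⟩, Option.some.injEq, iff_false]
      rintro rfl
      exact hi.1 hj'.1
    · rename_i hnone
      rw [if_neg, ih _ hi.2]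
      rintro ⟨j, hj⟩
      have := List.find?_eq_none.1 hnone j (List.mem_finRange j)
      simp only [decide_eq_true_eq] at this
      exact this hj

theorem inducedCluster_eq_candidateCluster {i : Fin k} {T : Finset (Fin k)}
    {L L' : List (Finset (Fin k))} (h : IsOrderedPartition (L ++ T :: L')) (hiT : i ∈ T) :
    i ∉ unionOf L ∧ inducedCluster f μ (L ++ T :: L') i =
      candidateCluster f μ i L (Finset.univ \ unionOf L) := by
  obtain ⟨hpair, hcov⟩ := h
  rw [List.pairwise_append, List.pairwise_cons] at hpair
  obtain ⟨_, ⟨hT, _⟩, hL⟩ := hpair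
  have hiL : i ∉ unionOf L := fun hi => by
    obtain ⟨T₀, hT₀, hi₀⟩ := mem_unionOf.1 hi
    exact Finset.disjoint_left.1 (hL T₀ hT₀ T (by simp)) hi₀ hiT
  have hiL' : i ∉ unionOf L' := fun hi => by
    obtain ⟨T₀, hT₀, hi₀⟩ := mem_unionOf.1 hi
    exact Finset.disjoint_left.1 (hT T₀ hT₀) hiT hi₀
  have hS : T ∪ unionOf L' = Finset.univ \ unionOf L := by
    ext j
    rw [← unionOf_cons, Finset.mem_sdiff, mem_unionOf, mem_unionOf]
    constructor
    · rintro ⟨T₁, hT₁, hj₁⟩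
      refine ⟨Finset.mem_univ _, ?_⟩
      rintro ⟨T₀, hT₀, hj₀⟩
      exact Finset.disjoint_left.1 (hL T₀ hT₀ T₁ hT₁) hj₀ hj₁
    · rintro ⟨_, hj⟩
      obtain ⟨T₀, hT₀, hj₀⟩ := hcov j
      rcases List.mem_append.1 hT₀ with h | h
      · exact absurd ⟨T₀, h, hj₀⟩ hj
      · exact ⟨T₀, h, hj₀⟩
  refine ⟨hiL, ?_⟩
  ext x
  rw [mem_inducedCluster, mem_candidateCluster, ← hS,
    hyperplanePartitioningFrom_eq_some_iff hiT hiL' L ∅ hiL]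

theorem mem_exclusiveSet_of_isInsideFrom {x : V} {i : Fin k} {S : Finset (Fin k)} :
    ∀ (L : List (Finset (Fin k))) (P : Finset (Fin k)), IsInsideFrom f μ x i S P L →
      x ∈ exclusiveSet f μ (P ∪ unionOf L) S i := by
  intro L
  induction L with
  | nil => intro P h; simpa [IsInsideFrom, unionOf] using h
  | cons T L ih =>
    intro P h
    rw [IsInsideFrom] at h
    split_ifs at h
    rw [unionOf_cons, ← Finset.union_assoc]
    exact ih _ h

open Classical in
/-- An unprocessed center `i` competes in every stage already passed, so a stage can only take away
vertices that miss the threshold set of the projection of `μ i` at that stage. -/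
theorem card_not_isInsideFrom_le {Ci : Finset V} {i : Fin k} {S : Finset (Fin k)} {e : ℝ}
    (hi : i ∈ S)
    (happrox : ∀ P, i ∉ P → ((Ci \ thresholdSet f (projCenter μ P i) 0.93).card : ℝ) ≤ e) :
    ∀ (L : List (Finset (Fin k))) (P : Finset (Fin k)), i ∉ P → i ∉ unionOf L →
      ((Ci.filter fun x => ¬ IsInsideFrom f μ x i S P L).card : ℝ) ≤
        L.length * e + (Ci \ exclusiveSet f μ (P ∪ unionOf L) S i).card := by
  intro L
  induction L with
  | nil =>
    intro P _ _
    simp only [List.length_nil, Nat.cast_zero, zero_mul, zero_add, Nat.cast_le]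
    refine Finset.card_le_card fun x hx => ?_
    rw [Finset.mem_filter, IsInsideFrom] at hx
    rw [show P ∪ unionOf ([] : List (Finset (Fin k))) = P from Finset.union_empty P]
    exact Finset.mem_sdiff.2 hx
  | cons T L ih =>
    intro P hP hL
    rw [unionOf_cons, Finset.mem_union, not_or] at hL
    have h1 := ih (P ∪ T) (by simp [hP, hL.1]) hL.2
    have h2 : (Ci.filter fun x => ¬ IsInsideFrom f μ x i S P (T :: L)) ⊆
        (Ci \ thresholdSet f (projCenter μ P i) 0.93) ∪
          Ci.filter fun x => ¬ IsInsideFrom f μ x i S (P ∪ T) L := by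
      intro x hx
      rw [Finset.mem_filter, IsInsideFrom] at hx
      rw [Finset.mem_union, Finset.mem_sdiff, Finset.mem_filter]
      by_cases hst : ∃ j ∈ T, x ∈ exclusiveSet f μ P (T ∪ unionOf L ∪ S) j
      · obtain ⟨j, hjT, hj⟩ := hst
        refine Or.inl ⟨hx.1, (mem_exclusiveSet.1 hj).2 i (Finset.mem_union_right _ hi) ?_⟩
        rintro rfl
        exact hL.1 hjT
      · rw [if_neg hst] at hx
        exact Or.inr hx
    have h3 : ((Ci.filter fun x => ¬ IsInsideFrom f μ x i S P (T :: L)).card : ℝ) ≤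
        (Ci \ thresholdSet f (projCenter μ P i) 0.93).card +
          (Ci.filter fun x => ¬ IsInsideFrom f μ x i S (P ∪ T) L).card := by
      exact_mod_cast (Finset.card_le_card h2).trans (Finset.card_union_le _ _)
    rw [unionOf_cons, ← Finset.union_assoc, List.length_cons]
    push_cast
    linarith [happrox P hP]

end Procedure

/-! ### One stage of the main loop -/

section Stage

variable {V : Type*} [Fintype V] [DecidableEq V] {k : ℕ} {f : V → EuclideanSpace ℝ (Fin k)}
  {μ : Fin k → EuclideanSpace ℝ (Fin k)} {C : Fin k → Finset V} {η β : ℝ}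

/-- The number of vertices of `C i`, with multiplicity, that lie in the threshold sets of the
projections of the centers in `S` other than `μ i`. -/
noncomputable def overlap (f : V → EuclideanSpace ℝ (Fin k)) (μ : Fin k → EuclideanSpace ℝ (Fin k))
    (C : Fin k → Finset V) (P S : Finset (Fin k)) (i : Fin k) : ℝ :=
  ∑ j ∈ S.erase i, ((C i ∩ thresholdSet f (projCenter μ P j) 0.93).card : ℝ)

theorem card_candidateCluster_sdiff_le
    (happrox : ∀ P i, i ∉ P →
      ((symmDiff (thresholdSet f (projCenter μ P i) 0.93) (C i)).card : ℝ) ≤ η * (C i).card)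
    {i : Fin k} {L : List (Finset (Fin k))} {S : Finset (Fin k)} (hi : i ∉ unionOf L) :
    ((candidateCluster f μ i L S \ C i).card : ℝ) ≤ η * (C i).card := by
  refine le_trans ?_ (happrox _ i hi)
  rw [Nat.cast_le]
  refine Finset.card_le_card fun x hx => ?_
  rw [Finset.mem_sdiff, mem_candidateCluster] at hx
  have h1 := mem_exclusiveSet_of_isInsideFrom L ∅ hx.1
  rw [Finset.empty_union] at h1
  exact Finset.mem_symmDiff.2 (Or.inl ⟨(mem_exclusiveSet.1 h1).1, hx.2⟩)

/-- The candidate cluster of `i` loses and gains at most `η |C i|` vertices each through its own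
threshold set, and loses at most `η |C i|` more in each earlier stage, besides the overlap. -/
theorem card_symmDiff_candidateCluster_le
    (happrox : ∀ P i, i ∉ P →
      ((symmDiff (thresholdSet f (projCenter μ P i) 0.93) (C i)).card : ℝ) ≤ η * (C i).card)
    {i : Fin k} {L : List (Finset (Fin k))} {S : Finset (Fin k)} (hiL : i ∉ unionOf L)
    (hiS : i ∈ S) :
    ((symmDiff (candidateCluster f μ i L S) (C i)).card : ℝ) ≤
      (2 + L.length) * η * (C i).card + overlap f μ C (unionOf L) S i := by
  classical
  have happrox' : ∀ P, i ∉ P →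
      ((C i \ thresholdSet f (projCenter μ P i) 0.93).card : ℝ) ≤ η * (C i).card := fun P hP =>
    le_trans (by exact_mod_cast card_sdiff_le_card_symmDiff _ _) (happrox P i hP)
  have h1 := card_candidateCluster_sdiff_le happrox (S := S) hiL
  have h2 := card_not_isInsideFrom_le hiS happrox' L ∅ (by simp) hiL
  have h3 : C i \ candidateCluster f μ i L S =
      (C i).filter fun x => ¬ IsInsideFrom f μ x i S ∅ L := by
    ext x
    rw [Finset.mem_sdiff, mem_candidateCluster, Finset.mem_filter]
  rw [← h3, Finset.empty_union] at h2
  have h4 : C i \ exclusiveSet f μ (unionOf L) S i ⊆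
      (C i \ thresholdSet f (projCenter μ (unionOf L) i) 0.93) ∪
        (S.erase i).biUnion fun j => C i ∩ thresholdSet f (projCenter μ (unionOf L) j) 0.93 := by
    intro x hx
    rw [Finset.mem_sdiff, mem_exclusiveSet, not_and] at hx
    rw [Finset.mem_union, Finset.mem_sdiff, Finset.mem_biUnion]
    by_cases hxH : x ∈ thresholdSet f (projCenter μ (unionOf L) i) 0.93
    · have := hx.2 hxH
      push Not at this
      obtain ⟨j, hjS, hji, hj⟩ := this
      exact Or.inr ⟨j, Finset.mem_erase.2 ⟨hji, hjS⟩, Finset.mem_inter.2 ⟨hx.1, hj⟩⟩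
    · exact Or.inl ⟨hx.1, hxH⟩
  have h5 : ((C i \ exclusiveSet f μ (unionOf L) S i).card : ℝ) ≤
      (C i \ thresholdSet f (projCenter μ (unionOf L) i) 0.93).card +
        overlap f μ C (unionOf L) S i := by
    rw [overlap]
    exact_mod_cast (Finset.card_le_card h4).trans
      ((Finset.card_union_le _ _).trans (Nat.add_le_add_left Finset.card_biUnion_le _))
  have h6 : ((symmDiff (candidateCluster f μ i L S) (C i)).card : ℝ) ≤
      (candidateCluster f μ i L S \ C i).card + (C i \ candidateCluster f μ i L S).card := by
    exact_mod_cast Finset.card_union_le _ _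
  linarith [happrox' _ hiL]

/-- The threshold sets of the unprocessed centers misclassify at most `η` times the total size of
their clusters, so by averaging few clusters can suffer from large overlaps. -/
theorem four_mul_card_large_overlap_le (hη : 0 ≤ η)
    (hdisj : ∀ i j, i ≠ j → Disjoint (C i) (C j))
    (hbal : ∀ i j, ((C i).card : ℝ) ≤ β * (C j).card)
    (happrox : ∀ P i, i ∉ P →
      ((symmDiff (thresholdSet f (projCenter μ P i) 0.93) (C i)).card : ℝ) ≤ η * (C i).card)
    {P S : Finset (Fin k)} (hPS : Disjoint S P) (B : Finset (Fin k)) (hB : B ⊆ S)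
    (hlarge : ∀ i ∈ B, 4 * β * η * (C i).card < overlap f μ C P S i) : 4 * B.card ≤ S.card := by
  rcases B.eq_empty_or_nonempty with rfl | hne
  · simp
  set H : Fin k → Finset V := fun j => thresholdSet f (projCenter μ P j) 0.93 with hH
  obtain ⟨z, hz, hmax⟩ := S.exists_max_image (fun j => (C j).card) (hne.mono hB)
  have hone : ∀ j ∈ S, ∑ i ∈ S.erase j, ((C i ∩ H j).card : ℝ) ≤ η * (C z).card := fun j hj => by
    have h1 : ∑ i ∈ S.erase j, (C i ∩ H j).card ≤ (symmDiff (H j) (C j)).card := by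
      rw [← Finset.card_biUnion fun i _ l _ hil =>
        (hdisj i l hil).mono Finset.inter_subset_left Finset.inter_subset_left]
      refine Finset.card_le_card fun x hx => ?_
      obtain ⟨i, hi, hx⟩ := Finset.mem_biUnion.1 hx
      rw [Finset.mem_inter] at hx
      exact Finset.mem_symmDiff.2 (Or.inl ⟨hx.2, fun hxj =>
        Finset.disjoint_left.1 (hdisj i j (Finset.ne_of_mem_erase hi)) hx.1 hxj⟩)
    calc ∑ i ∈ S.erase j, ((C i ∩ H j).card : ℝ) ≤ (symmDiff (H j) (C j)).card := by
          exact_mod_cast h1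
      _ ≤ η * (C j).card := happrox P j (Finset.disjoint_left.1 hPS hj)
      _ ≤ η * (C z).card := mul_le_mul_of_nonneg_left (by exact_mod_cast hmax j hj) hη
  have hsum : ∑ i ∈ S, overlap f μ C P S i ≤ S.card * (η * (C z).card) := by
    have hswap : ∑ i ∈ S, overlap f μ C P S i = ∑ j ∈ S, ∑ i ∈ S.erase j, ((C i ∩ H j).card : ℝ) :=
      Finset.sum_comm' fun i j => by simp only [Finset.mem_erase]; tauto
    rw [hswap, ← nsmul_eq_mul]
    exact Finset.sum_le_card_nsmul _ _ _ hone
  have hlow : B.card * (4 * (η * (C z).card)) < ∑ i ∈ B, overlap f μ C P S i := by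
    rw [← nsmul_eq_mul, ← Finset.sum_const]
    refine Finset.sum_lt_sum_of_nonempty hne fun i hi => lt_of_le_of_lt ?_ (hlarge i hi)
    have := mul_le_mul_of_nonneg_left (hbal z i) hη
    linarith
  have hBS : ∑ i ∈ B, overlap f μ C P S i ≤ ∑ i ∈ S, overlap f μ C P S i :=
    Finset.sum_le_sum_of_subset_of_nonneg hB fun i _ _ => Finset.sum_nonneg fun j _ =>
      Nat.cast_nonneg _
  by_contra hcon
  have h1 : (S.card : ℝ) ≤ 4 * B.card := by exact_mod_cast (not_le.1 hcon).le
  have h2 : 0 ≤ η * (C z).card := by positivity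
  nlinarith

end Stage

/-! ### The main loop -/

section Loop

variable {V : Type*} [Fintype V] [DecidableEq V] {k : ℕ} {f : V → EuclideanSpace ℝ (Fin k)}
  {μ : Fin k → EuclideanSpace ℝ (Fin k)} {G : SimpleGraph V} [DecidableRel G.Adj] {d : ℕ}
  {r τ : ℝ}

open Classical in
/-- If every stage accepts at least three quarters of the unprocessed centers, fewer than `4 ^ n`
unprocessed centers are exhausted within `n` stages.  Every center `i` then lies in a stage `T`, and
`L`, the list of the stages before `T`, is the one with respect to which `i` passed the test. -/
theorem computeOrderedPartitionLoop_spec {N : ℕ}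
    (hpass : ∀ L : List (Finset (Fin k)), L.length < N →
      4 * ((Finset.univ \ unionOf L).filter fun i =>
        ¬ exactOuterConductance f μ G d r i L (Finset.univ \ unionOf L) ≤ (τ : EReal)).card ≤
        (Finset.univ \ unionOf L).card) :
    ∀ (n : ℕ) (Ts : List (Finset (Fin k))), Ts.length + n = N → Ts.Pairwise Disjoint →
      (Finset.univ \ unionOf Ts).Nonempty → (Finset.univ \ unionOf Ts).card < 4 ^ n →
      ∃ Ts', computeOrderedPartitionLoop f μ G d r τ n Ts (Finset.univ \ unionOf Ts) = some Ts' ∧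
        IsOrderedPartition Ts' ∧ Ts <+: Ts' ∧
        ∀ i ∈ Finset.univ \ unionOf Ts, ∃ L T L', Ts' = L ++ T :: L' ∧ i ∈ T ∧
          exactOuterConductance f μ G d r i L (Finset.univ \ unionOf L) ≤ (τ : EReal) := by
  intro n
  induction n with
  | zero =>
    intro Ts _ _ hne hcard
    have := hne.card_pos
    omega
  | succ n ih =>
    intro Ts hlen hpair hne hcard
    set S := Finset.univ \ unionOf Ts with hS
    set T := S.filter fun i => exactOuterConductance f μ G d r i Ts S ≤ (τ : EReal) with hT
    have hloop : computeOrderedPartitionLoop f μ G d r τ (n + 1) Ts S =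
        if S \ T = ∅ then some (Ts ++ [T])
        else computeOrderedPartitionLoop f μ G d r τ n (Ts ++ [T]) (S \ T) := rfl
    have hTS : ∀ i ∈ T, i ∉ unionOf Ts := fun i hi => by
      have := (Finset.mem_filter.1 hi).1
      simpa [hS] using this
    have hpair' : (Ts ++ [T]).Pairwise Disjoint := by
      rw [List.pairwise_append]
      refine ⟨hpair, by simp, fun T₀ hT₀ T₁ hT₁ => ?_⟩
      rw [List.mem_singleton.1 hT₁]
      exact Finset.disjoint_left.2 fun i hi₀ hi => hTS i hi (mem_unionOf.2 ⟨T₀, hT₀, hi₀⟩)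
    have hST : S \ T = Finset.univ \ unionOf (Ts ++ [T]) := by
      rw [unionOf_append, unionOf_cons, hS, show unionOf ([] : List (Finset (Fin k))) = ∅ from rfl,
        Finset.union_empty, Finset.sdiff_union_distrib]
      ext i
      simp
    have hacc : ∀ i ∈ T, exactOuterConductance f μ G d r i Ts S ≤ (τ : EReal) := fun i hi =>
      (Finset.mem_filter.1 hi).2
    by_cases hend : S \ T = ∅
    · refine ⟨Ts ++ [T], by rw [hloop, if_pos hend], ⟨hpair', fun i => ?_⟩, ⟨[T], rfl⟩,
        fun i hi => ?_⟩
      · have : i ∈ unionOf (Ts ++ [T]) := by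
          by_contra hi
          have : i ∈ S \ T := by rw [hST]; simpa using hi
          simp [hend] at this
        exact mem_unionOf.1 this
      · have hiT : i ∈ T := Finset.sdiff_eq_empty_iff_subset.1 hend hi
        exact ⟨Ts, T, [], rfl, hiT, hacc i hiT⟩
    · have h4 := hpass Ts (by omega)
      have hrest : S \ T = S.filter fun i =>
          ¬ exactOuterConductance f μ G d r i Ts S ≤ (τ : EReal) :=
        (Finset.filter_not _ _).symm
      rw [← hS, ← hrest] at h4
      rw [hST] at hend h4
      obtain ⟨Ts', h1, h2, ⟨L', rfl⟩, h3⟩ := ih (Ts ++ [T]) (by simp; omega) hpair'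
        (Finset.nonempty_iff_ne_empty.2 hend) (by rw [pow_succ] at hcard; omega)
      refine ⟨_, by rw [hloop, hST, if_neg hend, h1], h2, ⟨T :: L', by simp⟩, fun i hi => ?_⟩
      by_cases hiT : i ∈ T
      · exact ⟨Ts, T, L', by simp, hiT, hacc i hiT⟩
      · exact h3 i (by rw [← hST]; exact Finset.mem_sdiff.2 ⟨hi, hiT⟩)

end Loop

/-! ### The conductance test -/

section Test

variable {V : Type*} [Fintype V] [DecidableEq V] {k : ℕ} {f : V → EuclideanSpace ℝ (Fin k)}
  {μ : Fin k → EuclideanSpace ℝ (Fin k)} {G : SimpleGraph V} [DecidableRel G.Adj] {d : ℕ}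
  {r τ : ℝ} {i : Fin k} {L : List (Finset (Fin k))} {S : Finset (Fin k)}

theorem exactOuterConductance_le_iff :
    exactOuterConductance f μ G d r i L S ≤ (τ : EReal) ↔
      (candidateCluster f μ i L S).Nonempty ∧ r ≤ (candidateCluster f μ i L S).card ∧
        outerConductance G d (candidateCluster f μ i L S) ≤ τ := by
  rw [exactOuterConductance, Finset.nonempty_iff_ne_empty]
  split_ifs with h
  · simp only [top_le_iff, EReal.coe_ne_top, false_iff]
    rintro ⟨h1, h2, -⟩
    exact h.elim h1 (not_lt.2 h2)
  · rw [not_or, not_lt] at h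
    simp [h.1, h.2]

theorem exactOuterConductance_le_of_symmDiff_le (hd : 0 < d) (hG : G.IsRegularOfDegree d)
    {Ci : Finset V} (hne : Ci.Nonempty) {ε ζ : ℝ} (hε : outerConductance G d Ci ≤ ε)
    (hε0 : 0 ≤ ε) (hζ0 : 0 ≤ ζ) (hζ : ζ ≤ 1 / 2) (hr : r ≤ (Ci.card : ℝ) / 2)
    (h : ((symmDiff (candidateCluster f μ i L S) Ci).card : ℝ) ≤ ζ * Ci.card)
    (hτ : 2 * (ε + ζ) ≤ τ) :
    exactOuterConductance f μ G d r i L S ≤ (τ : EReal) := by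
  have h1 := half_card_le_of_symmDiff_le hζ h
  have h2 : (0 : ℝ) < Ci.card := by exact_mod_cast hne.card_pos
  have h3 : (0 : ℝ) < (candidateCluster f μ i L S).card := by linarith
  exact exactOuterConductance_le_iff.2 ⟨Finset.card_pos.1 (by exact_mod_cast h3), hr.trans h1,
    (outerConductance_le_of_symmDiff_le hd hG hne hε hε0 hζ0 hζ h).trans hτ⟩

/-- Below conductance `φ` the internal expansion of the clusters controls the missing part of
`C i`; above it the trivial bound suffices, because then `τ / φ ≥ 1`. -/
theorem card_symmDiff_le_of_outerConductance_le {φ ε β η : ℝ} {C : Fin k → Finset V}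
    (hd : 0 < d) (hφ : 0 < φ) (hC : IsClustering G d φ ε β C)
    {b : ℝ} (hb : 1 ≤ b) (hbal : ∀ i j, ((C i).card : ℝ) ≤ b * (C j).card) {D : Finset V}
    (hne : D.Nonempty) (hη0 : 0 ≤ η) (hη : η * b ≤ 1 / 2) (hτ0 : 0 ≤ τ)
    (hD : ((D \ C i).card : ℝ) ≤ η * (C i).card) (hτ : outerConductance G d D ≤ τ) :
    ((symmDiff D (C i)).card : ℝ) ≤ (2 * (τ / φ) + η) * (C i).card := by
  have hm : (0 : ℝ) ≤ (C i).card := Nat.cast_nonneg _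
  have hη1 : η ≤ 1 := by nlinarith
  have hsymm : ((symmDiff D (C i)).card : ℝ) ≤ (D \ C i).card + (C i \ D).card := by
    exact_mod_cast Finset.card_union_le _ _
  suffices h : ((C i \ D).card : ℝ) ≤ 2 * (τ / φ) * (C i).card by linarith
  rcases lt_or_ge τ φ with hlt | hge
  · have h1 := card_sdiff_le_of_outerConductance_le hd hC hbal hne hη0 hη hD hτ hlt
    have h2 : (D.card : ℝ) ≤ (D \ C i).card + (C i).card := by
      have h3 := Finset.card_sdiff_add_card_inter D (C i)
      have h4 := Finset.card_le_card (Finset.inter_subset_right : D ∩ C i ⊆ C i)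
      exact_mod_cast (by omega : D.card ≤ (D \ C i).card + (C i).card)
    have h5 : (D.card : ℝ) ≤ 2 * (C i).card := by nlinarith
    rw [show 2 * (τ / φ) * ((C i).card : ℝ) = τ * (2 * (C i).card) / φ by ring, le_div_iff₀ hφ]
    nlinarith [mul_le_mul_of_nonneg_left h5 hτ0]
  · have h1 : 1 ≤ τ / φ := by rwa [le_div_iff₀ hφ, one_mul]
    have h2 : ((C i \ D).card : ℝ) ≤ (C i).card := by
      exact_mod_cast Finset.card_le_card Finset.sdiff_subset
    nlinarith

end Test

theorem IsClustering.card_le {V : Type*} [Fintype V] [DecidableEq V] {G : SimpleGraph V}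
    [DecidableRel G.Adj] {d k : ℕ} {φ ε β : ℝ} {C : Fin k → Finset V}
    (hC : IsClustering G d φ ε β C) (i j : Fin k) :
    ((C i).card : ℝ) ≤ max β 1 * (C j).card := by
  have hj : (0 : ℝ) < (C j).card := by exact_mod_cast (hC.nonempty j).card_pos
  have h := hC.balanced i j
  rw [div_le_iff₀ hj] at h
  exact h.trans (mul_le_mul_of_nonneg_right (le_max_left _ _) hj.le)

end SpectralClustering

/-- `β` bounds the ratios of cluster sizes, `A` is the constant of the conductance test of the
algorithm, and `r` is the size below which the conductance procedure may report `∞`. -/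
theorem mainTheorem9 (β : ℝ) :
    ∃ A₀ : ℝ, 0 < A₀ ∧ ∀ A : ℝ, A₀ ≤ A → ∃ c : ℝ, 0 < c ∧ ∃ B : ℝ, 0 < B ∧
      ∀ (V : Type*) [Fintype V] [DecidableEq V] (G : SimpleGraph V) [DecidableRel G.Adj]
        (d k : ℕ) (phi eps : ℝ) (C : Fin k → Finset V) (f : V → EuclideanSpace ℝ (Fin k)) (r : ℝ),
        0 < d → G.IsRegularOfDegree d → 2 ≤ k → 0 < phi → phi < 1 → 0 ≤ eps →
        eps / phi ^ 2 * Real.logb 2 k ≤ c →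
        IsClustering G d phi eps β C →
        IsSpectralEmbedding G d f →
        (∀ p, r ≤ ((C p).card : ℝ) / 2) →
        Function.Injective (clusterMean f C) ∧
        ∃ Ts : List (Finset (Fin k)),
          computeOrderedPartition f (clusterMean f C) G d r
            (A * (eps / phi ^ 2 * Real.logb 2 k)) = some Ts ∧
          IsOrderedPartition Ts ∧
          ∃ π : Equiv.Perm (Fin k), ∀ i : Fin k,
            ((symmDiff (inducedCluster f (clusterMean f C) Ts i) (C (π i))).card : ℝ) ≤
              B * (eps / phi ^ 3 * Real.logb 2 k) * ((C (π i)).card : ℝ) ∧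
            (inducedCluster f (clusterMean f C) Ts i).Nonempty ∧
            outerConductance G d (inducedCluster f (clusterMean f C) Ts i) ≤
              B * (eps / phi ^ 2 * Real.logb 2 k) := by
  set b := max β 1 with hbdef
  have hb : 1 ≤ b := le_max_right _ _
  -- `1000 ε / φ²` is the relative error of a threshold set, and `1000 (3 + 4 b) ε / φ² log k`
  -- that of the candidate cluster of a center with small overlaps
  refine ⟨2 * (1 + 1000 * (3 + 4 * b)), by positivity, fun A hA =>
    ⟨1 / (2000 * (3 + 4 * b)), by positivity, 2 * A + 1000, by linarith, ?_⟩⟩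
  intro V _ _ G _ d k phi eps C f r hd hG hk hφ hφ1 hε hσ hC hf hr
  set l := Real.logb 2 k with hl
  set s := eps / phi ^ 2 with hs
  have hl1 : 1 ≤ l := by
    rw [hl, Real.le_logb_iff_rpow_le (by norm_num) (by positivity), Real.rpow_one]
    exact_mod_cast hk
  have hs0 : 0 ≤ s := by positivity
  have hsl : s ≤ s * l := le_mul_of_one_le_right hs0 hl1
  have hσ' : 2000 * (3 + 4 * b) * (s * l) ≤ 1 := by
    rw [le_div_iff₀ (by positivity)] at hσ
    linarith
  have hbs : b * s ≤ b * (s * l) := mul_le_mul_of_nonneg_left hsl (by linarith)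
  have hbs0 : 0 ≤ b * s := mul_nonneg (by linarith) hs0
  have hεs : eps ≤ s := by
    rw [hs, le_div_iff₀ (by positivity)]
    nlinarith [pow_le_one₀ hφ.le hφ1.le (n := 2)]
  obtain ⟨c, hc⟩ := hC.exists_label
  have hm : ∀ i, (0 : ℝ) < (C i).card := fun i => by exact_mod_cast (hC.nonempty i).card_pos
  have hbal := hC.card_le
  rw [← hbdef] at hbal
  have hemb := hf.isotropic_and_variance_le hd hG hφ hC
  rw [← hs] at hemb
  have hfr := frame_bounds hc hC.nonempty (fun α => (hemb α).1) (fun α => (hemb α).2)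
  have happrox : ∀ P i, i ∉ P → ((symmDiff (thresholdSet f (projCenter (clusterMean f C) P i) 0.93)
      (C i)).card : ℝ) ≤ 1000 * s * (C i).card := fun P i hi => by
    have := card_symmDiff_thresholdSet_le hc hC.nonempty (fun α => (hemb α).1)
      (fun α => (hemb α).2) hbal (by linarith) (by nlinarith) hi
    linarith
  refine ⟨center_injective hm (δ := 4 * s) (by nlinarith) fun α => (hfr α).1, ?_⟩
  set μ := clusterMean f C with hμ
  set τ := A * (s * l) with hτ
  have hτ0 : 0 ≤ τ := mul_nonneg (by linarith) (by linarith)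
  -- a center with small overlaps passes the conductance test
  have hacc : ∀ L : List (Finset (Fin k)), L.length < ⌈l⌉₊ → ∀ i ∈ Finset.univ \ unionOf L,
      overlap f μ C (unionOf L) (Finset.univ \ unionOf L) i ≤
        4 * b * (1000 * s) * (C i).card →
      exactOuterConductance f μ G d r i L (Finset.univ \ unionOf L) ≤ (τ : EReal) := by
    intro L hL i hi hov
    have hLl : (L.length : ℝ) ≤ l := (Nat.lt_ceil.1 hL).le
    have h1 := card_symmDiff_candidateCluster_le happrox (by simpa using hi) hi
    refine exactOuterConductance_le_of_symmDiff_le hd hG (hC.nonempty i) (hC.outer i) hε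
      (ζ := 1000 * (3 + 4 * b) * (s * l)) (by positivity) (by linarith) (hr i) ?_ ?_
    · refine (h1.trans (add_le_add_right hov _)).trans ?_
      rw [← add_mul]
      refine mul_le_mul_of_nonneg_right ?_ (hm i).le
      have := mul_le_mul_of_nonneg_right hLl hs0
      linarith
    · have := mul_le_mul_of_nonneg_right hA (show 0 ≤ s * l by linarith)
      linarith
  have hpass : ∀ L : List (Finset (Fin k)), L.length < ⌈l⌉₊ →
      4 * ((Finset.univ \ unionOf L).filter fun i =>
        ¬ exactOuterConductance f μ G d r i L (Finset.univ \ unionOf L) ≤ (τ : EReal)).card ≤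
        (Finset.univ \ unionOf L).card := fun L hL =>
    four_mul_card_large_overlap_le (by positivity) hC.disjoint hbal happrox
      Finset.sdiff_disjoint _ (Finset.filter_subset _ _) fun i hi => by
        rw [Finset.mem_filter] at hi
        by_contra hov
        exact hi.2 (hacc L hL i hi.1 (not_lt.1 hov))
  have huniv : Finset.univ \ unionOf ([] : List (Finset (Fin k))) = Finset.univ :=
    Finset.sdiff_empty
  -- the number of stages is positive as `k ≥ 2`, which makes `k ≤ 2 ^ ⌈log k⌉ < 4 ^ ⌈log k⌉` strict
  have hcard : Fintype.card (Fin k) < 4 ^ ⌈l⌉₊ := by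
    rw [Fintype.card_fin]
    have h1 : (k : ℝ) ≤ 2 ^ ⌈l⌉₊ := by
      rw [← Real.rpow_natCast, ← Real.logb_le_iff_le_rpow (by norm_num) (by positivity)]
      exact Nat.le_ceil l
    have h2 : k ≤ 2 ^ ⌈l⌉₊ := by exact_mod_cast h1
    have h3 : 0 < ⌈l⌉₊ := Nat.ceil_pos.2 (by linarith)
    exact h2.trans_lt (Nat.pow_lt_pow_left (by norm_num) h3.ne')
  obtain ⟨Ts, hTs, hord, -, hspec⟩ := computeOrderedPartitionLoop_spec hpass ⌈l⌉₊ [] (by simp)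
    List.Pairwise.nil (by rw [huniv]; exact ⟨⟨0, by omega⟩, Finset.mem_univ _⟩)
    (by rw [huniv]; exact hcard)
  rw [huniv] at hTs hspec
  refine ⟨Ts, hTs, hord, Equiv.refl _, fun i => ?_⟩
  obtain ⟨L, T, L', rfl, hiT, hpassed⟩ := hspec i (Finset.mem_univ i)
  obtain ⟨hiL, hind⟩ := inducedCluster_eq_candidateCluster (f := f) (μ := μ) hord hiT
  obtain ⟨hne, -, hcond⟩ := exactOuterConductance_le_iff.1 hpassed
  rw [hind, Equiv.refl_apply]
  refine ⟨?_, hne, ?_⟩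
  · refine (card_symmDiff_le_of_outerConductance_le hd hφ hC hb hbal hne (by positivity)
      (by nlinarith) hτ0 (card_candidateCluster_sdiff_le happrox hiL) hcond).trans ?_
    refine mul_le_mul_of_nonneg_right ?_ (hm i).le
    have h1 : τ / phi = A * (eps / phi ^ 3 * l) := by
      rw [hτ, hs]; field_simp
    have h2 : s ≤ eps / phi ^ 3 * l := by
      refine hsl.trans (mul_le_mul_of_nonneg_right ?_ (by linarith))
      exact div_le_div_of_nonneg_left hε (by positivity)
        (pow_le_pow_of_le_one hφ.le hφ1.le (by norm_num))
    rw [h1]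
    linarith
  · refine hcond.trans ?_
    have := mul_nonneg (show 0 ≤ A + 1000 by linarith) (show 0 ≤ s * l by linarith)
    rw [hτ]
    linarith
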